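/- Let $n\ge 0$ and let $S:\mathbb{R}\rightrightarrows\mathbb{R}^n$ be a multivalued map with graph $\mathcal{S}=\{(t,x):x\in S(t)\}\subset\mathbb{R}^{n+1}$, $\mathrm{dom}(S)=\{t:S(t)\ne\emptyset\}$ and $T=\sup\mathrm{dom}(S)$. Euclidean norms are used throughout. **Definitions.** The Fréchet normal cone $\hat N_C(x)$ of a set $C$ at $x\in C$ consists of all $v$ with $\limsup_{y\to x,\,y\in C}\langle v,y-x\rangle/\|y-x\|\le 0$; the limiting normal cone $N_C(x)$ consists of all limits of sequences $v_i\in\hat N_C(x_i)$ with $x_i\in C$, $x_i\to x$. The coderivative is $D^*S(t,x)(u)=\{\alpha\in\mathbb{R}:(\alpha,-u)\in N_{\mathcal{S}}(t,x)\}$, its asymmetric modulus is $\|D^*S(t,x)|^+=\sup\{\alpha^+:\alpha\in D^*S(t,x)(u),\ \|u\|\le1\}\in[0,\infty]$ (with $\sup\emptyset=0$), and the oriented talweg is $\varphi^{\uparrow}(t)=\sup_{x\in S(t)}\|D^*S(t,x)|^+$. For an interval $I\subset\mathrm{dom}(S)$, an orbit on $I$ is a curve $\gamma:I\to\mathbb{R}^n$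 with $\gamma(t)\in S(t)$ for all $t\in I$ and $-\dot\gamma(t)\in N_{S(t)}(\gamma(t))$ for almost every $t\in I$; $\mathcal{AC}(S,I)$ is the set of absolutely continuous orbits and $\mathcal{PAC}(S,I)$ the set of orbits for which there is a closed countable set $D$ such that $\gamma$ is absolutely continuous on the intervals contained in $I\setminus D$. The length is $\ell(\gamma)=\int_I\|\dot\gamma(t)\|\,dt\in[0,\infty]$. **Assumptions.** $S$ is a smooth sweeping process: $\mathcal{S}$ is closed and connected, and is either a $C^1$ submanifold of $\mathbb{R}^{n+1}$ of dimension at most $n$, or a full-dimensional manifold with boundary whose boundary is a $C^1$ manifold of dimension $n$. All values $S(t)$ are bounded. (A1) holds: for every $(t,x)\in\mathcal{S}$ with $\|D^*S(t,x)|^+<\infty$ there are $\delta>0$ and $\gamma\in\mathcal{AC}(S,[t,t+\delta))$ with $\gamma(t)=x$. Finally $a\in\mathrm{dom}(S)$, $a<T$, and for some $\delta>0$: (A2) $\varphi^{\uparrow}(t)<\infty$ for all $t\in(a,a+\delta)$; (A3) the map $t\mapsto\partial\mathcal{S}\cap(\{t\}\times\mathbb{R}^n)$ is continuous on $(a,a+\delta)$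 for the Pompeiu–Hausdorff distance, where $\partial\mathcal{S}$ is the topological boundary of $\mathcal{S}$ in $\mathbb{R}^{n+1}$. **Theorem A.** The following assertions are equivalent: (a) There exist $b>a$, $\rho>0$ and a homeomorphism $\Psi:[0,\rho]\to[a,b]$ which is a $C^1$-diffeomorphism between $(0,\rho)$ and $(a,b)$ with $\Psi'(r)>0$ for all $r\in(0,\rho)$, such that $\|D^*(S\circ\Psi)(r,x)|^+\le1$ for all $r\in(0,\rho)$ and all $x\in S(\Psi(r))$. (b) There exist $b>a$ and an increasing (i.e. nondecreasing) continuous function $\sigma:[a,b]\to[0,\infty)$ with $\sigma(a)=0$ such that $\ell(\gamma)\le\sigma(t_2)-\sigma(t_1)$ for all $a\le t_1<t_2\le b$ and all $\gamma\in\mathcal{AC}(S,[t_1,t_2])$. (c) There exist $b>a$ with $\mathcal{PAC}(S,[a,b])\neq\emptyset$ and $M>0$ such that $\ell(\gamma)\le M$ for every $\gamma\in\mathcal{PAC}(S,[a,b])$. (d) There exists $b>a$ with $[a,b]\subset\mathrm{dom}(S)$ and $\int_a^b\varphi^{\uparrow}(t)\,dt<\infty$. -/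

import Mathlib

open Set Filter Topology MeasureTheory
open scoped ENNReal

noncomputable section

namespace Sweeping

/-! ### Normal cones -/

section Normal

variable {F : Type*} [NormedAddCommGroup F] [InnerProductSpace ℝ F]

/-- Fréchet normal cone to `C` at `x`: all `v` with
`limsup_{y → x, y ∈ C} ⟪v, y - x⟫ / ‖y - x‖ ≤ 0`, written without division. -/
def frechetNormalCone (C : Set F) (x : F) : Set F :=
  {v | ∀ ε : ℝ, 0 < ε → ∀ᶠ y in 𝓝[C] x, inner ℝ v (y - x) ≤ ε * ‖y - x‖}

/-- Limiting normal cone to `C` at `x`. -/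
def limitingNormalCone (C : Set F) (x : F) : Set F :=
  {v | ∃ (y : ℕ → F) (w : ℕ → F), (∀ i, y i ∈ C) ∧ (∀ i, w i ∈ frechetNormalCone C (y i)) ∧
    Tendsto y atTop (𝓝 x) ∧ Tendsto w atTop (𝓝 v)}

/-- `M` is an (embedded) `C¹` submanifold of dimension `d`: near each of its points it is the zero
set of a `C¹` submersion into `ℝᵏ`, where `d + k = dim F`. -/
def IsC1Submanifold (d : ℕ) (M : Set F) : Prop :=
  ∀ p ∈ M, ∃ k : ℕ, d + k = Module.finrank ℝ F ∧
    ∃ (U : Set F) (g : F → EuclideanSpace ℝ (Fin k)), IsOpen U ∧ p ∈ U ∧ ContDiffOn ℝ 1 g U ∧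
      (∀ q ∈ U, Function.Surjective (fderiv ℝ g q)) ∧ M ∩ U = {q ∈ U | g q = 0}

/-- The closed set `M` is a full-dimensional manifold with boundary whose boundary is a `C¹`
hypersurface: near each point of its topological boundary it is a sublevel set `{g ≤ 0}` of a
`C¹` function `g` without critical points (points off the boundary are interior points). -/
def IsFullDimC1WithBoundary (M : Set F) : Prop :=
  ∀ p ∈ frontier M, ∃ (U : Set F) (g : F → ℝ), IsOpen U ∧ p ∈ U ∧ ContDiffOn ℝ 1 g U ∧ g p = 0 ∧
    (∀ q ∈ U, fderiv ℝ g q ≠ 0) ∧ M ∩ U = {q ∈ U | g q ≤ 0}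

end Normal

/-! ### Multivalued maps `S : ℝ ⇉ ℝⁿ`, coderivative and oriented talweg -/

/-- `ℝⁿ` with the Euclidean norm. -/
abbrev E (n : ℕ) : Type := EuclideanSpace ℝ (Fin n)

/-- `ℝ × ℝⁿ = ℝⁿ⁺¹` with the Euclidean norm. -/
abbrev TE (n : ℕ) : Type := WithLp 2 (ℝ × E n)

variable {n : ℕ}

/-- Effective domain. -/
def dom (S : ℝ → Set (E n)) : Set ℝ := {t | (S t).Nonempty}

/-- `T = sup (dom S)`, in the extended reals. -/
def endTime (S : ℝ → Set (E n)) : EReal := ⨆ t ∈ dom S, (t : EReal)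

/-- The graph of `S`. -/
def gph (S : ℝ → Set (E n)) : Set (TE n) := {p | p.snd ∈ S p.fst}

/-- The limiting coderivative `D*S(t,x)(u)`. -/
def coderivative (S : ℝ → Set (E n)) (t : ℝ) (x : E n) (u : E n) : Set ℝ :=
  {a | WithLp.toLp 2 (a, -u) ∈ limitingNormalCone (gph S) (WithLp.toLp 2 (t, x))}

/-- The asymmetric modulus `sup {a⁺ : a ∈ D*S(t,x)(u), ‖u‖ ≤ 1}` of the coderivative, with values
in `[0, ∞]` (`ENNReal.ofReal a` is `a⁺`; the supremum of the empty set is `0`). -/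
def asymModulus (S : ℝ → Set (E n)) (t : ℝ) (x : E n) : ℝ≥0∞ :=
  ⨆ (u : E n) (_ : ‖u‖ ≤ 1) (a : ℝ) (_ : a ∈ coderivative S t x u), ENNReal.ofReal a

/-- The oriented talweg `φ↑`. -/
def talweg (S : ℝ → Set (E n)) (t : ℝ) : ℝ≥0∞ := ⨆ x ∈ S t, asymModulus S t x

/-- The composition `S ∘ Ψ` of `S` with a map `Ψ` defined on the set `I` (with empty values
off `I`). -/
def compOn (S : ℝ → Set (E n)) (Ψ : ℝ → ℝ) (I : Set ℝ) : ℝ → Set (E n) :=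
  fun r => {x | r ∈ I ∧ x ∈ S (Ψ r)}

/-! ### Orbits of the sweeping process -/

/-- `γ` is an orbit of the sweeping process defined by `S` on the interval `I`, regardless of its
regularity: `γ(t) ∈ S(t)` for all `t ∈ I`, and `γ` is differentiable with
`-γ'(t) ∈ N_{S(t)}(γ(t))` for almost every `t ∈ I`. -/
def SolvesSweeping (S : ℝ → Set (E n)) (I : Set ℝ) (γ : ℝ → E n) : Prop :=
  (∀ t ∈ I, γ t ∈ S t) ∧
  ∀ᵐ t ∂(volume.restrict I),
    DifferentiableAt ℝ γ t ∧ -deriv γ t ∈ limitingNormalCone (S t) (γ t)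

/-- Absolutely continuous orbits on the interval `I` (absolute continuity on the compact
subintervals of `I`, so on `I` itself if `I` is compact). -/
def AC (S : ℝ → Set (E n)) (I : Set ℝ) : Set (ℝ → E n) :=
  {γ | (∀ c d : ℝ, c ≤ d → Icc c d ⊆ I → AbsolutelyContinuousOnInterval γ c d) ∧
    SolvesSweeping S I γ}

/-- Piecewise absolutely continuous orbits on the interval `I`: there is a closed countable set `D`
such that the orbit is absolutely continuous on the intervals contained in `I \ D`. -/
def PAC (S : ℝ → Set (E n)) (I : Set ℝ) : Set (ℝ → E n) :=
  {γ | (∃ D : Set ℝ, IsClosed D ∧ D.Countable ∧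
      ∀ c d : ℝ, c ≤ d → Icc c d ⊆ I \ D → AbsolutelyContinuousOnInterval γ c d) ∧
    SolvesSweeping S I γ}

/-- The length `∫_I ‖γ'(t)‖ dt`, with values in `[0, ∞]`. -/
def length (I : Set ℝ) (γ : ℝ → E n) : ℝ≥0∞ := ∫⁻ t in I, ‖deriv γ t‖ₑ

/-! ### Smooth sweeping processes and assumptions -/

/-- `S` is a smooth sweeping process: its graph is closed, connected, and either a `C¹` submanifold
of `ℝⁿ⁺¹` of dimension at most `n`, or a full-dimensional manifold with `C¹` boundary. -/
structure IsSmoothSweepingProcess (S : ℝ → Set (E n)) : Prop where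
  closed : IsClosed (gph S)
  connected : IsConnected (gph S)
  smooth : (∃ d ≤ n, IsC1Submanifold d (gph S)) ∨ IsFullDimC1WithBoundary (gph S)

/-- `H_S(t) = ∂(gph S) ∩ ({t} × ℝⁿ)`. -/
def HS (S : ℝ → Set (E n)) (t : ℝ) : Set (TE n) := frontier (gph S) ∩ {p | p.fst = t}

/-- (A1), the existence assumption. -/
def ExistenceAssumption (S : ℝ → Set (E n)) : Prop :=
  ∀ t : ℝ, ∀ x ∈ S t, asymModulus S t x < ∞ →
    ∃ δ : ℝ, 0 < δ ∧ ∃ γ ∈ AC S (Ico t (t + δ)), γ t = x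

/-- (A2), the upper regularity assumption at `t₀`. -/
def UpperRegularAt (S : ℝ → Set (E n)) (t₀ : ℝ) : Prop :=
  ∃ δ : ℝ, 0 < δ ∧ ∀ t ∈ Ioo t₀ (t₀ + δ), talweg S t < ∞

/-- (A3), the continuity assumption at `t₀`: `H_S` is continuous for the Pompeiu-Hausdorff distance
on some interval `(t₀, t₀ + δ)`. -/
def ContinuityAssumptionAt (S : ℝ → Set (E n)) (t₀ : ℝ) : Prop :=
  ∃ δ : ℝ, 0 < δ ∧ ∀ t ∈ Ioo t₀ (t₀ + δ),
    Tendsto (fun s => Metric.hausdorffEDist (HS S s) (HS S t)) (𝓝 t) (𝓝 0)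

/-- The set `𝒯` of all `t ∈ dom S`, `t < T`, at which (A2) and (A3) hold. -/
def regularTimes (S : ℝ → Set (E n)) : Set ℝ :=
  {t | t ∈ dom S ∧ (t : EReal) < endTime S ∧ UpperRegularAt S t ∧ ContinuityAssumptionAt S t}

/-- `Ψ : [0, ρ] → [a, b]` is a homeomorphism, which is a `C¹`-diffeomorphism between `(0, ρ)` and
`(a, b)` with `Ψ' > 0` on `(0, ρ)`; `Θ` is the inverse map. -/
structure IsTimeChange (Ψ : ℝ → ℝ) (ρ a b : ℝ) : Prop where
  homeo : ∃ Θ : ℝ → ℝ, MapsTo Ψ (Icc 0 ρ) (Icc a b) ∧ MapsTo Θ (Icc a b) (Icc 0 ρ) ∧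
    InvOn Θ Ψ (Icc 0 ρ) (Icc a b) ∧ ContinuousOn Ψ (Icc 0 ρ) ∧ ContinuousOn Θ (Icc a b) ∧
    MapsTo Ψ (Ioo 0 ρ) (Ioo a b) ∧ MapsTo Θ (Ioo a b) (Ioo 0 ρ) ∧
    ContDiffOn ℝ 1 Ψ (Ioo 0 ρ) ∧ ContDiffOn ℝ 1 Θ (Ioo a b)
  deriv_pos : ∀ r ∈ Ioo 0 ρ, 0 < deriv Ψ r

end Sweeping

end

/-!
The argument rests on two facts about an orbit `γ` of a smooth sweeping process.

*Speed and coderivative.* A differentiable selection `γ` of `S` makes `(1, γ'(t))` a two-sided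
tangent of the graph, so every normal `(α, -u)` at `(t, γ(t))` satisfies `α ≤ ⟪u, γ'(t)⟫`. Hence the
modulus of the coderivative is at most `‖γ'(t)‖` (`asymModulus_le_enorm_deriv`). Conversely, that
tangent makes the graph transversal to the slice `{t} × S(t)`, so that the normal `-γ'(t)` of
`S(t)` lifts to the normal `(‖γ'(t)‖², -γ'(t))` of the graph (`lift_normal`), and `‖γ'(t)‖` is at
most the modulus (`enorm_deriv_le_asymModulus`). In particular `‖γ'‖ ≤ φ↑` almost everywhere, so
integrability of `φ↑` bounds the lengths of the orbits.

*Fast orbits.* The talweg `φ↑` is continuous to the right of `a` (`continuousAt_talweg`). An orbit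
that starts at a point where `φ↑(t)` is nearly attained, with positive modulus, cannot leave the
boundary of the graph at once, and there the modulus is continuous; so its speed is at least `φ↑ - 1` for a while
(`exists_fast_orbit`). Length bounds therefore bound the integral of `φ↑`: for absolutely continuous
orbits by continuous induction (`lintegral_talweg_lt_top_of_length_control`), for piecewise
absolutely continuous ones by gluing countably many fast orbits (`exists_glued_orbit`).

Under a time change `Ψ` the modulus is multiplied by `Ψ'` (`asymModulus_mul_deriv_le`). So a
desingularizing `Ψ` with inverse `Θ` gives `φ↑ ≤ Θ'`, which is integrable; conversely, if `φ↑` is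
integrable, `Θ(t) = ∫ₐᵗ (φ↑ + 1)` is the inverse of a desingularizing time change.

Both kinds of smooth graphs are treated at once: near a boundary point the graph is `{g ∈ K}` for a
`C¹` submersion `g` and a closed pointed convex cone `K`, either `{0}` or a half-line
(`IsConicChart`). A right inverse of `Dg(p)` shows that the normal cone is the polar of the
linearized cone `{v | Dg(p) v ∈ K}`, that limiting normals are Fréchet normals, and that normals at
`p` are limits of normals at nearby boundary points.
-/

namespace Sweeping

/-! ### Normal cones of sets with a conic chart -/

section Chart

lemma tendsto_clm_comp {ι E₁ E₂ E₃ : Type*} [NormedAddCommGroup E₁] [NormedSpace ℝ E₁]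
    [NormedAddCommGroup E₂] [NormedSpace ℝ E₂] [NormedAddCommGroup E₃] [NormedSpace ℝ E₃]
    {l : Filter ι} {P : ι → E₂ →L[ℝ] E₃} {Q : ι → E₁ →L[ℝ] E₂} {P₀ : E₂ →L[ℝ] E₃}
    {Q₀ : E₁ →L[ℝ] E₂} (hP : Tendsto P l (𝓝 P₀)) (hQ : Tendsto Q l (𝓝 Q₀)) :
    Tendsto (fun i => P i ∘L Q i) l (𝓝 (P₀ ∘L Q₀)) :=
  ((continuous_fst.clm_comp continuous_snd :
    Continuous fun z : (E₂ →L[ℝ] E₃) × (E₁ →L[ℝ] E₂) => z.1 ∘L z.2).tendsto (P₀, Q₀)).comp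
    (hP.prodMk_nhds hQ)

lemma tendsto_clm_apply {ι E₁ E₂ : Type*} [NormedAddCommGroup E₁] [NormedSpace ℝ E₁]
    [NormedAddCommGroup E₂] [NormedSpace ℝ E₂] {l : Filter ι} {P : ι → E₁ →L[ℝ] E₂}
    {P₀ : E₁ →L[ℝ] E₂} (hP : Tendsto P l (𝓝 P₀)) (v : E₁) :
    Tendsto (fun i => P i v) l (𝓝 (P₀ v)) :=
  ((ContinuousLinearMap.apply ℝ E₂ v).continuous.tendsto P₀).comp hP

variable {F : Type*} [NormedAddCommGroup F] [InnerProductSpace ℝ F]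
variable {G : Type*} [NormedAddCommGroup G] [NormedSpace ℝ G]

/-- A chart of `C` on the open set `U`: there `C` is the preimage of a closed pointed convex cone
`K` under a `C¹` submersion `g`. The cone `K = {0}` gives submanifolds, a half-line gives
manifolds with boundary. -/
structure IsConicChart (C U : Set F) (g : F → G) (K : Set G) : Prop where
  isOpen : IsOpen U
  contDiffOn : ContDiffOn ℝ 1 g U
  surjective : ∀ q ∈ U, Function.Surjective (fderiv ℝ g q)
  closed : IsClosed K
  add_mem : ∀ z ∈ K, ∀ z' ∈ K, z + z' ∈ K
  smul_mem : ∀ r : ℝ, 0 ≤ r → ∀ z ∈ K, r • z ∈ K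
  pointed : ∀ z ∈ K, -z ∈ K → z = 0
  mem_iff : ∀ q ∈ U, q ∈ C ↔ g q ∈ K

/-- The polar of the linearized cone `{v | Dg(q) v ∈ K}`. -/
def polarAt (g : F → G) (K : Set G) (q : F) : Set F :=
  {w | ∀ v, fderiv ℝ g q v ∈ K → inner ℝ w v ≤ 0}

lemma IsConicChart.hasStrictFDerivAt {C U : Set F} {g : F → G} {K : Set G}
    (h : IsConicChart C U g K) {q : F} (hq : q ∈ U) : HasStrictFDerivAt g (fderiv ℝ g q) q :=
  (h.contDiffOn.contDiffAt (h.isOpen.mem_nhds hq)).hasStrictFDerivAt one_ne_zero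

lemma IsConicChart.tendsto_fderiv {C U : Set F} {g : F → G} {K : Set G}
    (h : IsConicChart C U g K) {q : F} (hq : q ∈ U) :
    Tendsto (fderiv ℝ g) (𝓝 q) (𝓝 (fderiv ℝ g q)) :=
  (h.contDiffOn.continuousOn_fderiv_of_isOpen h.isOpen le_rfl).continuousAt
    (h.isOpen.mem_nhds hq)

/-- A submersion attains the values `g q + h A v` at points within `o(h)` of `q + h v`. -/
lemma eventually_exists_preimage [CompleteSpace F] [FiniteDimensional ℝ G]
    {g : F → G} {A : F →L[ℝ] G} {q : F}
    (hg : HasStrictFDerivAt g A q) (hA : Function.Surjective A) {W : Set F} (hW : W ∈ 𝓝 q)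
    (v : F) {η : ℝ} (hη : 0 < η) :
    ∀ᶠ h in 𝓝[>] (0 : ℝ), ∃ z ∈ W, ‖z - (q + h • v)‖ ≤ η * h ∧ g z = g q + h • A v := by
  obtain ⟨B, hB⟩ := ContinuousLinearMap.exists_rightInverse_of_surjective A
    (LinearMap.range_eq_top.2 hA)
  have hB' : ∀ y, A (B y) = y := fun y => by
    simpa using congrArg (fun L : G →L[ℝ] G => L y) hB
  let N : A.NonlinearRightInverse :=
    { toFun := B
      nnnorm := ‖B‖₊ + 1
      bound' := fun y => (B.le_opNorm y).trans (by
        gcongr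
        simp)
      right_inv' := hB' }
  have hN : (0 : ℝ) < N.nnnorm := by
    change (0 : ℝ) < ((‖B‖₊ + 1 : NNReal) : ℝ)
    positivity
  set c : NNReal := N.nnnorm⁻¹ / 2 with hc
  have hc0 : 0 < c := by
    have : 0 < N.nnnorm := by exact_mod_cast hN
    positivity
  have hcc : ((N.nnnorm : ℝ)⁻¹ - c) = c := by
    rw [hc]; push_cast; ring
  obtain ⟨s, hs, hsa⟩ := hg.approximates_deriv_on_nhds (c := c) (Or.inr hc0)
  obtain ⟨r, hr, hrs⟩ := Metric.nhds_basis_closedBall.mem_iff.1 (inter_mem hs hW)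
  have h1 : ∀ᶠ h in 𝓝[>] (0 : ℝ), h * (‖v‖ + η) < r := by
    have : Tendsto (fun h : ℝ => h * (‖v‖ + η)) (𝓝 0) (𝓝 0) :=
      Continuous.tendsto' (by fun_prop) _ _ (by simp)
    exact (this.eventually (gt_mem_nhds hr)).filter_mono nhdsWithin_le_nhds
  have h2 : ∀ᶠ h in 𝓝[>] (0 : ℝ), ‖g (q + h • v) - g q - A (h • v)‖ ≤ c * η * h := by
    have hd : (fun y => g (q + y) - g q - A y) =o[𝓝 0] fun y => y :=
      hasFDerivAt_iff_isLittleO_nhds_zero.1 hg.hasFDerivAt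
    have ht : Tendsto (fun h : ℝ => h • v) (𝓝[>] 0) (𝓝 0) := by
      have : Tendsto (fun h : ℝ => h • v) (𝓝 0) (𝓝 0) :=
        Continuous.tendsto' (by fun_prop) _ _ (by simp)
      exact this.mono_left nhdsWithin_le_nhds
    have hk : 0 < c * η / (‖v‖ + 1) := by positivity
    filter_upwards [ht.eventually (hd.bound hk), self_mem_nhdsWithin] with h hh hpos
    have hpos' : (0 : ℝ) < h := hpos
    refine hh.trans ?_
    rw [norm_smul, Real.norm_of_nonneg hpos'.le, div_mul_eq_mul_div,
      div_le_iff₀ (by positivity)]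
    have : 0 ≤ c * η * h := by positivity
    nlinarith [norm_nonneg v]
  filter_upwards [h1, h2, self_mem_nhdsWithin] with h hh1 hh2 hpos
  have hpos' : (0 : ℝ) < h := hpos
  have hball : Metric.closedBall (q + h • v) (η * h) ⊆ s ∩ W := by
    refine Subset.trans (fun z hz => ?_) hrs
    rw [Metric.mem_closedBall, dist_eq_norm] at hz ⊢
    calc ‖z - q‖ = ‖(z - (q + h • v)) + h • v‖ := by congr 1; abel
      _ ≤ η * h + h * ‖v‖ := by
        refine (norm_add_le _ _).trans (add_le_add hz ?_)
        rw [norm_smul, Real.norm_of_nonneg hpos'.le]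
      _ ≤ r := by linarith
  have := hsa.surjOn_closedBall_of_nonlinearRightInverse N (by positivity)
    (hball.trans inter_subset_left)
  rw [hcc] at this
  obtain ⟨z, hz, hgz⟩ := this (show g q + h • A v ∈ _ by
    rw [Metric.mem_closedBall, dist_eq_norm', ← map_smul]
    calc ‖g (q + h • v) - (g q + A (h • v))‖ = ‖g (q + h • v) - g q - A (h • v)‖ := by
          congr 1; abel
      _ ≤ c * (η * h) := by rw [← mul_assoc]; exact hh2)
  exact ⟨z, (hball hz).2, by rwa [Metric.mem_closedBall, dist_eq_norm] at hz, hgz⟩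

/-- Fréchet normals belong to the polar of the linearized cone. -/
lemma IsConicChart.frechet_subset_polarAt [CompleteSpace F] [FiniteDimensional ℝ G]
    {C U : Set F} {g : F → G} {K : Set G}
    (h : IsConicChart C U g K) {q : F} (hqU : q ∈ U) (hqC : q ∈ C) :
    frechetNormalCone C q ⊆ polarAt g K q := by
  intro w hw v hv
  have key : ∀ η : ℝ, 0 < η → η ≤ 1 → inner ℝ w v ≤ η * (‖w‖ + ‖v‖ + 1) := by
    intro η hη hη1
    have hU := h.isOpen.mem_nhds hqU
    obtain ⟨W, hW, hWC⟩ := (eventually_nhdsWithin_iff.1 (hw η hη)).exists_mem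
    obtain ⟨t, ⟨z, hz, hzt, hgz⟩, ht⟩ := ((eventually_exists_preimage
      (h.hasStrictFDerivAt hqU) (h.surjective q hqU) (inter_mem hU hW) v hη).and
        self_mem_nhdsWithin).exists
    have ht : (0 : ℝ) < t := ht
    have hzC : z ∈ C := (h.mem_iff z hz.1).2 (by
      rw [hgz]
      exact h.add_mem _ ((h.mem_iff q hqU).1 hqC) _ (h.smul_mem t ht.le _ hv))
    have h1 := hWC z hz.2 hzC
    have e : z - q = (z - (q + t • v)) + t • v := by abel
    have h2 : ‖z - q‖ ≤ η * t + t * ‖v‖ := by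
      rw [e]
      refine (norm_add_le _ _).trans (add_le_add hzt ?_)
      rw [norm_smul, Real.norm_of_nonneg ht.le]
    have h3 : inner ℝ w (z - q) ≥ t * inner ℝ w v - ‖w‖ * (η * t) := by
      rw [e, inner_add_right, inner_smul_right]
      have := neg_le_of_abs_le (abs_real_inner_le_norm w (z - (q + t • v)))
      have := mul_le_mul_of_nonneg_left hzt (norm_nonneg w)
      linarith
    have h4 : t * inner ℝ w v ≤ t * (η * (‖w‖ + ‖v‖ + 1)) := by
      have h5 := mul_le_mul_of_nonneg_left h2 hη.le
      have h6 : η * (η * t) ≤ 1 * (η * t) := by gcongr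
      nlinarith
    exact le_of_mul_le_mul_left h4 ht
  by_contra! hpos
  set a := inner ℝ w v
  set c := ‖w‖ + ‖v‖ + 1 with hc
  have hc0 : 0 < c := by positivity
  have hη : 0 < min 1 (a / (2 * c)) := lt_min one_pos (by positivity)
  have h1 := key _ hη (min_le_left _ _)
  have h2 : min 1 (a / (2 * c)) * c ≤ a / (2 * c) * c := by gcongr; exact min_le_right _ _
  have h3 : a / (2 * c) * c = a / 2 := by field_simp
  linarith

/-- Near a surjective `A`, the maps `A'` stay surjective, and vectors `v` can be corrected to
`v'` with `A' v' = A v`, with `v' → v` as `A' → A`. -/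
lemma exists_lift_near [FiniteDimensional ℝ G] {A : F →L[ℝ] G} (hA : Function.Surjective A) :
    ∃ R : (F →L[ℝ] G) → (F →L[ℝ] F), Tendsto R (𝓝 A) (𝓝 (ContinuousLinearMap.id ℝ F)) ∧
      ∀ᶠ A' : F →L[ℝ] G in 𝓝 A, Function.Surjective A' ∧ ∀ v, A' (R A' v) = A v := by
  obtain ⟨B, hB⟩ := ContinuousLinearMap.exists_rightInverse_of_surjective A
    (LinearMap.range_eq_top.2 hA)
  have hT : Tendsto (fun A' : F →L[ℝ] G => A' ∘L B) (𝓝 A) (𝓝 1) := by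
    have hcont : Continuous fun A' : F →L[ℝ] G => A' ∘L B :=
      continuous_id.clm_comp continuous_const
    have := hcont.tendsto A
    rwa [hB] at this
  have hI : Tendsto (fun A' : F →L[ℝ] G => Ring.inverse (A' ∘L B)) (𝓝 A) (𝓝 1) := by
    have h1 : ContinuousAt Ring.inverse (((1 : (G →L[ℝ] G)ˣ)) : G →L[ℝ] G) :=
      NormedRing.inverse_continuousAt 1
    have h2 : Tendsto Ring.inverse (𝓝 (1 : G →L[ℝ] G)) (𝓝 1) := by
      simpa [ContinuousAt] using h1
    exact h2.comp hT
  refine ⟨fun A' => ContinuousLinearMap.id ℝ F - B ∘L Ring.inverse (A' ∘L B) ∘L (A' - A), ?_, ?_⟩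
  · have h1 : Tendsto (fun A' : F →L[ℝ] G => A' - A) (𝓝 A) (𝓝 0) :=
      Continuous.tendsto' (by fun_prop) _ _ (sub_self A)
    have h2 : Tendsto (fun A' : F →L[ℝ] G => B ∘L Ring.inverse (A' ∘L B) ∘L (A' - A)) (𝓝 A)
        (𝓝 (B ∘L (1 : G →L[ℝ] G) ∘L (0 : F →L[ℝ] G))) :=
      tendsto_clm_comp (tendsto_const_nhds (x := B)) (tendsto_clm_comp hI h1)
    simpa using h2.const_sub (ContinuousLinearMap.id ℝ F)
  · have hu : ∀ᶠ A' : F →L[ℝ] G in 𝓝 A, IsUnit (A' ∘L B) :=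
      hT.eventually (Units.isOpen.mem_nhds isUnit_one)
    filter_upwards [hu] with A' hA'
    have hr : ∀ y, A' (B (Ring.inverse (A' ∘L B) y)) = y := fun y => by
      have := congrArg (fun L : G →L[ℝ] G => L y) (Ring.mul_inverse_cancel _ hA')
      simpa using this
    refine ⟨fun y => ⟨_, hr y⟩, fun v => ?_⟩
    simp only [sub_apply, ContinuousLinearMap.comp_apply, map_sub,
      ContinuousLinearMap.id_apply]
    rw [hr, hr]
    abel

/-- Limiting normals belong to the polar of the linearized cone. -/
lemma IsConicChart.limiting_subset_polarAt [CompleteSpace F] [FiniteDimensional ℝ G]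
    {C U : Set F} {g : F → G} {K : Set G}
    (h : IsConicChart C U g K) {p : F} (hp : p ∈ U) :
    limitingNormalCone C p ⊆ polarAt g K p := by
  rintro w ⟨y, w', hyC, hw', hy, hw⟩ v hv
  obtain ⟨R, hR, hRA⟩ := exists_lift_near (h.surjective p hp)
  have hA := (h.tendsto_fderiv hp).comp hy
  have hRv : Tendsto (fun i => R (fderiv ℝ g (y i)) v) atTop (𝓝 v) := by
    have := tendsto_clm_apply (hR.comp hA) v
    simpa using this
  refine le_of_tendsto (hw.inner hRv) ?_
  filter_upwards [hA.eventually hRA, hy.eventually (h.isOpen.mem_nhds hp)] with i hi hiU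
  refine h.frechet_subset_polarAt hiU (hyC i) (hw' i) _ ?_
  rw [show fderiv ℝ g (y i) (R (fderiv ℝ g (y i)) v) = fderiv ℝ g p v from hi.2 v]
  exact hv

/-- At the zeros of the chart map, the polar of the linearized cone consists of Fréchet normals. -/
lemma IsConicChart.polarAt_subset_frechet [FiniteDimensional ℝ G]
    {C U : Set F} {g : F → G} {K : Set G}
    (h : IsConicChart C U g K) {q : F} (hqU : q ∈ U) (hq0 : g q = 0) :
    polarAt g K q ⊆ frechetNormalCone C q := by
  intro w hw ε hε
  obtain ⟨B, hB⟩ := ContinuousLinearMap.exists_rightInverse_of_surjective (fderiv ℝ g q)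
    (LinearMap.range_eq_top.2 (h.surjective q hqU))
  have hB' : ∀ y, fderiv ℝ g q (B y) = y := fun y => by
    simpa using congrArg (fun L : G →L[ℝ] G => L y) hB
  have hd : (fun y => g y - g q - fderiv ℝ g q (y - q)) =o[𝓝 q] fun y => y - q :=
    (h.hasStrictFDerivAt hqU).hasFDerivAt.isLittleO
  have hk : 0 < ε / (‖w‖ * ‖B‖ + 1) := by positivity
  rw [eventually_nhdsWithin_iff]
  filter_upwards [hd.bound hk, h.isOpen.mem_nhds hqU] with y hy hyU hyC
  -- the correction of `y - q` that lies in the linearized cone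
  set e := g y - g q - fderiv ℝ g q (y - q) with he
  have h1 : inner ℝ w (y - q + B e) ≤ 0 := by
    apply hw
    rw [map_add, hB', he, hq0]
    have := (h.mem_iff y hyU).1 hyC
    simpa using this
  rw [inner_add_right] at h1
  have h2 := neg_le_of_abs_le (abs_real_inner_le_norm w (B e))
  have h3 : ‖w‖ * ‖B e‖ ≤ (‖w‖ * ‖B‖) * (ε / (‖w‖ * ‖B‖ + 1) * ‖y - q‖) := by
    rw [mul_assoc]
    refine mul_le_mul_of_nonneg_left ((B.le_opNorm e).trans ?_) (norm_nonneg w)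
    gcongr
  have h4 : (‖w‖ * ‖B‖) * (ε / (‖w‖ * ‖B‖ + 1) * ‖y - q‖) ≤ ε * ‖y - q‖ := by
    rw [← mul_assoc]
    gcongr
    rw [mul_div_assoc', div_le_iff₀ (by positivity)]
    nlinarith [mul_nonneg (norm_nonneg w) (norm_nonneg B)]
  linarith

/-- Inner semicontinuity of the polar of the linearized cone. -/
lemma IsConicChart.exists_tendsto_polarAt [CompleteSpace F] [FiniteDimensional ℝ G]
    {C U : Set F} {g : F → G} {K : Set G}
    (h : IsConicChart C U g K) {p : F} (hp : p ∈ U) {w : F} (hw : w ∈ polarAt g K p) :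
    ∃ W : F → F, Tendsto W (𝓝 p) (𝓝 w) ∧ ∀ q, W q ∈ polarAt g K q := by
  obtain ⟨B, hB⟩ := ContinuousLinearMap.exists_rightInverse_of_surjective (fderiv ℝ g p)
    (LinearMap.range_eq_top.2 (h.surjective p hp))
  have hB' : ∀ y, fderiv ℝ g p (B y) = y := fun y => by
    simpa using congrArg (fun L : G →L[ℝ] G => L y) hB
  let D : F → F →L[ℝ] F := fun q =>
    ContinuousLinearMap.id ℝ F - B ∘L (fderiv ℝ g p - fderiv ℝ g q)
  refine ⟨fun q => ContinuousLinearMap.adjoint (D q) w, ?_, fun q v hv => ?_⟩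
  · have h1 : Tendsto (fun q => fderiv ℝ g p - fderiv ℝ g q) (𝓝 p) (𝓝 0) := by
      simpa using (h.tendsto_fderiv hp).const_sub (fderiv ℝ g p)
    have h2 : Tendsto D (𝓝 p) (𝓝 (ContinuousLinearMap.id ℝ F)) := by
      simpa [D] using (tendsto_clm_comp (tendsto_const_nhds (x := B)) h1).const_sub
        (ContinuousLinearMap.id ℝ F)
    have h3 := ((ContinuousLinearMap.adjoint (𝕜 := ℝ) (E := F) (F := F)).continuous.tendsto
      (ContinuousLinearMap.id ℝ F)).comp h2
    have h4 := tendsto_clm_apply h3 w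
    rw [ContinuousLinearMap.adjoint_id] at h4
    simpa using h4
  · rw [ContinuousLinearMap.adjoint_inner_left]
    apply hw
    simp only [D, sub_apply, ContinuousLinearMap.comp_apply, map_sub,
      ContinuousLinearMap.id_apply, hB']
    simpa using hv

end Chart

/-! ### Regularity of the normal cone -/

section Cones

variable {F : Type*} [NormedAddCommGroup F] [InnerProductSpace ℝ F]

lemma frechet_subset_limiting {C : Set F} {p : F} (hp : p ∈ C) :
    frechetNormalCone C p ⊆ limitingNormalCone C p := fun w hw =>
  ⟨fun _ => p, fun _ => w, fun _ => hp, fun _ => hw, tendsto_const_nhds, tendsto_const_nhds⟩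

lemma smul_mem_frechet {C : Set F} {p w : F} {r : ℝ} (hr : 0 ≤ r)
    (hw : w ∈ frechetNormalCone C p) : r • w ∈ frechetNormalCone C p := by
  intro ε hε
  filter_upwards [hw (ε / (r + 1)) (by positivity)] with y hy
  rw [real_inner_smul_left]
  calc r * inner ℝ w (y - p) ≤ r * (ε / (r + 1) * ‖y - p‖) := by gcongr
    _ = (r * ε / (r + 1)) * ‖y - p‖ := by ring
    _ ≤ ε * ‖y - p‖ := by
      gcongr
      rw [div_le_iff₀ (by positivity)]
      nlinarith

lemma smul_mem_limiting {C : Set F} {p w : F} {r : ℝ} (hr : 0 ≤ r)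
    (hw : w ∈ limitingNormalCone C p) : r • w ∈ limitingNormalCone C p := by
  obtain ⟨y, w', hy, hw', h1, h2⟩ := hw
  exact ⟨y, fun i => r • w' i, hy, fun i => smul_mem_frechet hr (hw' i), h1, h2.const_smul r⟩

/-- The graph of the limiting normal cone is closed. -/
lemma mem_limiting_of_tendsto {C : Set F} {p w : F} {y w' : ℕ → F}
    (hw' : ∀ i, w' i ∈ limitingNormalCone C (y i)) (hy : Tendsto y atTop (𝓝 p))
    (hw : Tendsto w' atTop (𝓝 w)) : w ∈ limitingNormalCone C p := by
  have : ∀ i : ℕ, ∃ z u, z ∈ C ∧ u ∈ frechetNormalCone C z ∧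
      dist z (y i) < 1 / ((i : ℝ) + 1) ∧ dist u (w' i) < 1 / ((i : ℝ) + 1) := fun i => by
    obtain ⟨z, u, hz, hu, h1, h2⟩ := hw' i
    have hi : (0 : ℝ) < 1 / ((i : ℝ) + 1) := by positivity
    obtain ⟨j, hj1, hj2⟩ := ((h1.eventually (Metric.ball_mem_nhds _ hi)).and
      (h2.eventually (Metric.ball_mem_nhds _ hi))).exists
    exact ⟨z j, u j, hz j, hu j, hj1, hj2⟩
  choose z u hz hu h1 h2 using this
  refine ⟨z, u, hz, hu, ?_, ?_⟩
  · refine hy.congr_dist (squeeze_zero (fun _ => dist_nonneg) (fun i => ?_)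
      tendsto_one_div_add_atTop_nhds_zero_nat)
    rw [dist_comm]
    exact (h1 i).le
  · refine hw.congr_dist (squeeze_zero (fun _ => dist_nonneg) (fun i => ?_)
      tendsto_one_div_add_atTop_nhds_zero_nat)
    rw [dist_comm]
    exact (h2 i).le

lemma frechet_eq_zero_of_interior {C : Set F} {p w : F} (hp : p ∈ interior C)
    (hw : w ∈ frechetNormalCone C p) : w = 0 := by
  have key : ∀ ε : ℝ, 0 < ε → ‖w‖ ≤ ε := by
    intro ε hε
    have h := hw ε hε
    rw [nhdsWithin_eq_nhds.2 (mem_interior_iff_mem_nhds.1 hp)] at h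
    have ht : Tendsto (fun r : ℝ => p + r • w) (𝓝[>] 0) (𝓝 p) :=
      (Continuous.tendsto' (by fun_prop) _ _ (by simp)).mono_left nhdsWithin_le_nhds
    obtain ⟨r, hr, hr0⟩ := ((ht.eventually h).and self_mem_nhdsWithin).exists
    have hr0 : (0 : ℝ) < r := hr0
    rw [add_sub_cancel_left, real_inner_smul_right, real_inner_self_eq_norm_sq, norm_smul,
      Real.norm_of_nonneg hr0.le] at hr
    by_contra! hlt
    have hw0 : 0 < ‖w‖ := hε.trans hlt
    have : r * ‖w‖ * ε < r * ‖w‖ * ‖w‖ := by gcongr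
    nlinarith
  exact norm_le_zero_iff.1 (le_of_forall_pos_le_add fun ε hε => by simpa using key ε hε)

lemma limiting_eq_zero_of_interior {C : Set F} {p w : F} (hp : p ∈ interior C)
    (hw : w ∈ limitingNormalCone C p) : w = 0 := by
  obtain ⟨y, w', hy, hw', h1, h2⟩ := hw
  refine tendsto_nhds_unique (h2.congr' ?_) tendsto_const_nhds
  filter_upwards [h1.eventually (isOpen_interior.mem_nhds hp)] with i hi
  exact frechet_eq_zero_of_interior hi (hw' i)

/-- Near `p`, the set `C` has a conic chart whose map vanishes on the boundary of `C`. -/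
def HasConicChart (C : Set F) (p : F) : Prop :=
  ∃ (G : Type) (_ : NormedAddCommGroup G) (_ : NormedSpace ℝ G) (_ : FiniteDimensional ℝ G)
    (U : Set F) (g : F → G) (K : Set G), p ∈ U ∧ IsConicChart C U g K ∧
      ∀ q ∈ U, q ∈ frontier C → g q = 0

lemma IsC1Submanifold.hasConicChart {d : ℕ} {C : Set F} (h : IsC1Submanifold d C)
    (hC : IsClosed C) : ∀ p ∈ frontier C, HasConicChart C p := by
  intro p hp
  obtain ⟨k, -, U, g, hU, hpU, hg, hs, hCU⟩ := h p (hC.frontier_subset hp)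
  have hiff : ∀ q ∈ U, q ∈ C ↔ g q ∈ ({0} : Set (EuclideanSpace ℝ (Fin k))) := fun q hq => by
    have : q ∈ C ∩ U ↔ q ∈ {q ∈ U | g q = 0} := by rw [hCU]
    simpa [hq] using this
  refine ⟨EuclideanSpace ℝ (Fin k), inferInstance, inferInstance, inferInstance, U, g, {0}, hpU,
    ⟨hU, hg, hs, isClosed_singleton, ?_, ?_, ?_, hiff⟩, ?_⟩
  · rintro z rfl z' rfl
    simp
  · rintro r - z rfl
    simp
  · rintro z rfl -
    rfl
  · exact fun q hq hqC => (hiff q hq).1 (hC.frontier_subset hqC)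

lemma IsFullDimC1WithBoundary.hasConicChart {C : Set F} (h : IsFullDimC1WithBoundary C)
    (hC : IsClosed C) : ∀ p ∈ frontier C, HasConicChart C p := by
  intro p hp
  obtain ⟨U, g, hU, hpU, hg, -, hs, hCU⟩ := h p hp
  have hiff : ∀ q ∈ U, q ∈ C ↔ g q ∈ Iic (0 : ℝ) := fun q hq => by
    have : q ∈ C ∩ U ↔ q ∈ {q ∈ U | g q ≤ 0} := by rw [hCU]
    simpa [hq] using this
  refine ⟨ℝ, inferInstance, inferInstance, inferInstance, U, g, Iic 0, hpU,
    ⟨hU, hg, ?_, isClosed_Iic, ?_, ?_, ?_, hiff⟩, ?_⟩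
  · intro q hq
    exact LinearMap.surjective (f := (fderiv ℝ g q : F →ₗ[ℝ] ℝ))
      (fun h0 => hs q hq (by ext v; exact congrArg (fun L : F →ₗ[ℝ] ℝ => L v) h0))
  · exact fun z hz z' hz' => add_nonpos (mem_Iic.1 hz) hz'
  · exact fun r hr z hz => mul_nonpos_of_nonneg_of_nonpos hr hz
  · exact fun z hz hz' => le_antisymm hz (by simpa using hz')
  · intro q hq hqC
    refine le_antisymm ((hiff q hq).1 (hC.frontier_subset hqC)) ?_
    by_contra! hlt
    refine hqC.2 (mem_interior_iff_mem_nhds.2 ?_)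
    filter_upwards [hU.mem_nhds hq, (hg.continuousOn.continuousAt (hU.mem_nhds hq)).eventually
      (gt_mem_nhds hlt)] with y hy hy'
    exact (hiff y hy).2 hy'.le

variable [FiniteDimensional ℝ F]

/-- Limiting normals are Fréchet normals. -/
lemma limiting_subset_frechet {C : Set F} (hC : ∀ p ∈ frontier C, HasConicChart C p) {p : F}
    (hp : p ∈ C) : limitingNormalCone C p ⊆ frechetNormalCone C p := by
  intro w hw
  by_cases hi : p ∈ interior C
  · rw [limiting_eq_zero_of_interior hi hw]
    intro ε hε
    filter_upwards with y
    rw [inner_zero_left]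
    positivity
  · have hf : p ∈ frontier C := ⟨subset_closure hp, hi⟩
    obtain ⟨G, _, _, _, U, g, K, hpU, hch, h0⟩ := hC p hf
    exact hch.polarAt_subset_frechet hpU (h0 p hpU hf) (hch.limiting_subset_polarAt hpU hw)

/-- The normal cone is inner semicontinuous along the boundary. -/
lemma exists_tendsto_limiting {C : Set F} (hcl : IsClosed C)
    (hC : ∀ p ∈ frontier C, HasConicChart C p) {p : F} (hp : p ∈ frontier C) {w : F}
    (hw : w ∈ limitingNormalCone C p) :
    ∃ W : F → F, Tendsto W (𝓝 p) (𝓝 w) ∧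
      ∀ᶠ q in 𝓝 p, q ∈ frontier C → W q ∈ limitingNormalCone C q := by
  obtain ⟨G, _, _, _, U, g, K, hpU, hch, h0⟩ := hC p hp
  obtain ⟨W, hW, hWq⟩ := hch.exists_tendsto_polarAt hpU (hch.limiting_subset_polarAt hpU hw)
  refine ⟨W, hW, ?_⟩
  filter_upwards [hch.isOpen.mem_nhds hpU] with q hq hqC
  exact frechet_subset_limiting (hcl.frontier_subset hqC)
    (hch.polarAt_subset_frechet hq (h0 q hq hqC) (hWq q))

end Cones

/-! ### Velocities of orbits and the coderivative -/

section Velocity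

variable {n : ℕ} {S : ℝ → Set (E n)}

lemma mem_gph_toLp {t : ℝ} {x : E n} : WithLp.toLp 2 (t, x) ∈ gph S ↔ x ∈ S t := Iff.rfl

/-- The embedding `y ↦ (0, y)`. -/
noncomputable def spaceIncl (n : ℕ) : E n →L[ℝ] TE n :=
  ((WithLp.prodContinuousLinearEquiv 2 ℝ ℝ (E n)).symm : (ℝ × E n) →L[ℝ] TE n) ∘L
    ContinuousLinearMap.inr ℝ ℝ (E n)

lemma spaceIncl_apply (y : E n) : spaceIncl n y = WithLp.toLp 2 ((0 : ℝ), y) := rfl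

lemma toLp_eq_add (t : ℝ) (y : E n) :
    (WithLp.toLp 2 (t, y) : TE n) = WithLp.toLp 2 (t, (0 : E n)) + spaceIncl n y := by
  rw [spaceIncl_apply, ← WithLp.toLp_add]
  simp

lemma continuous_toLp : Continuous fun z : ℝ × E n => (WithLp.toLp 2 z : TE n) :=
  (WithLp.prodContinuousLinearEquiv 2 ℝ ℝ (E n)).symm.continuous

lemma hasDerivAt_toLp {γ : ℝ → E n} {v : E n} {t : ℝ} (h : HasDerivAt γ v t) :
    HasDerivAt (fun s => (WithLp.toLp 2 (s, γ s) : TE n)) (WithLp.toLp 2 ((1 : ℝ), v)) t :=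
  (((WithLp.prodContinuousLinearEquiv 2 ℝ ℝ (E n)).symm : (ℝ × E n) →L[ℝ] TE n).hasFDerivAt
    ).comp_hasDerivAt t ((hasDerivAt_id t).prodMk h)

lemma inner_toLp (a b : ℝ) (x y : E n) :
    inner ℝ (WithLp.toLp 2 (a, x) : TE n) (WithLp.toLp 2 (b, y)) = a * b + inner ℝ x y := by
  rw [WithLp.prod_inner_apply]
  simp [mul_comm]

lemma mem_interior_slice {t : ℝ} {x : E n}
    (h : (WithLp.toLp 2 (t, x) : TE n) ∈ interior (gph S)) : x ∈ interior (S t) := by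
  rw [mem_interior_iff_mem_nhds] at h ⊢
  have hcont : Continuous fun y : E n => (WithLp.toLp 2 (t, y) : TE n) :=
    continuous_toLp.comp (by fun_prop)
  exact hcont.continuousAt h

/-- The derivative of a curve running in a closed pointed cone vanishes where the curve does. -/
lemma deriv_eq_zero_of_mem_cone {G : Type*} [NormedAddCommGroup G] [NormedSpace ℝ G] {K : Set G}
    (hcl : IsClosed K) (hsm : ∀ r : ℝ, 0 ≤ r → ∀ z ∈ K, r • z ∈ K)
    (hpt : ∀ z ∈ K, -z ∈ K → z = 0) {c : ℝ → G} {v : G} {t : ℝ} (hc : HasDerivAt c v t)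
    (h0 : c t = 0) (hK : ∀ᶠ s in 𝓝 t, c s ∈ K) : v = 0 := by
  have hs := hasDerivAt_iff_tendsto_slope.1 hc
  refine hpt v (hcl.mem_of_tendsto (hs.mono_left (nhdsGT_le_nhdsNE t)) ?_)
    (hcl.mem_of_tendsto (hs.mono_left (nhdsLT_le_nhdsNE t)).neg ?_)
  · filter_upwards [hK.filter_mono nhdsWithin_le_nhds, self_mem_nhdsWithin] with s hs hst
    have : t < s := hst
    rw [slope_def_module, h0, sub_zero]
    exact hsm _ (inv_nonneg.2 (by linarith)) _ hs
  · filter_upwards [hK.filter_mono nhdsWithin_le_nhds, self_mem_nhdsWithin] with s hs hst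
    have : s < t := hst
    rw [slope_def_module, h0, sub_zero, ← neg_smul, ← inv_neg]
    exact hsm _ (inv_nonneg.2 (by linarith)) _ hs

/-- A normal `-v` to a value of `S` at an orbit with velocity `v` lifts to a normal
`(‖v‖², -v)` to the graph: the tangent `(1, v)` makes the graph transversal to the slice. -/
lemma lift_normal (hC : ∀ p ∈ frontier (gph S), HasConicChart (gph S) p)
    {γ : ℝ → E n} {v : E n} {t : ℝ} (hγ : HasDerivAt γ v t) (hS : ∀ᶠ s in 𝓝 t, γ s ∈ S s)
    (hv : -v ∈ limitingNormalCone (S t) (γ t)) :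
    WithLp.toLp 2 (‖v‖ ^ 2, -v) ∈ limitingNormalCone (gph S) (WithLp.toLp 2 (t, γ t)) := by
  set p : TE n := WithLp.toLp 2 (t, γ t) with hp
  have hpC : p ∈ gph S := hS.self_of_nhds
  have hcont : Continuous fun y : E n => (WithLp.toLp 2 (t, y) : TE n) :=
    continuous_toLp.comp (by fun_prop)
  by_cases hi : p ∈ interior (gph S)
  · have hx : γ t ∈ interior (S t) := mem_interior_slice hi
    have h0 := limiting_eq_zero_of_interior hx hv
    have hv0 : v = 0 := neg_eq_zero.1 h0
    have h1 : (0 : TE n) ∈ frechetNormalCone (gph S) p := fun ε hε => by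
      filter_upwards with y
      rw [inner_zero_left]
      positivity
    have : (WithLp.toLp 2 (‖v‖ ^ 2, -v) : TE n) = 0 := by simp [hv0]
    rw [this]
    exact frechet_subset_limiting hpC h1
  · have hf : p ∈ frontier (gph S) := ⟨subset_closure hpC, hi⟩
    obtain ⟨G, _, _, _, U, g, K, hpU, hch, h0⟩ := hC p hf
    have hA1 : fderiv ℝ g p (WithLp.toLp 2 ((1 : ℝ), v)) = 0 := by
      have hc := (hch.hasStrictFDerivAt hpU).hasFDerivAt.comp_hasDerivAt t (hasDerivAt_toLp hγ)
      refine deriv_eq_zero_of_mem_cone hch.closed hch.smul_mem hch.pointed hc (h0 p hpU hf) ?_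
      have := (hasDerivAt_toLp hγ).continuousAt.eventually (hch.isOpen.mem_nhds hpU)
      filter_upwards [this, hS] with s hs hsS
      exact (hch.mem_iff _ hs).1 hsS
    have hsplit : ∀ τ (y : E n), fderiv ℝ g p (WithLp.toLp 2 (τ, y)) =
        fderiv ℝ g p (spaceIncl n (y - τ • v)) := fun τ y => by
      have : (WithLp.toLp 2 (τ, y) : TE n) =
          spaceIncl n (y - τ • v) + τ • WithLp.toLp 2 ((1 : ℝ), v) := by
        rw [spaceIncl_apply, ← WithLp.toLp_smul, ← WithLp.toLp_add]
        simp
      rw [this, map_add, map_smul, hA1, smul_zero, add_zero]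
    have hder : ∀ y, (WithLp.toLp 2 (t, y) : TE n) ∈ U →
        HasFDerivAt (fun y : E n => g (WithLp.toLp 2 (t, y)))
          (fderiv ℝ g (WithLp.toLp 2 (t, y)) ∘L spaceIncl n) y := fun y hy => by
      refine (hch.hasStrictFDerivAt hy).hasFDerivAt.comp y ?_
      have := (spaceIncl n).hasFDerivAt (x := y) |>.const_add (WithLp.toLp 2 (t, (0 : E n)))
      exact this.congr_of_eventuallyEq (Eventually.of_forall fun z => toLp_eq_add t z)
    have hsurj : Function.Surjective (fderiv ℝ g p ∘L spaceIncl n) := fun z => by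
      obtain ⟨q, hq⟩ := hch.surjective p hpU z
      exact ⟨q.snd - q.fst • v, by rw [← hq]; exact (hsplit q.fst q.snd).symm⟩
    obtain ⟨R, -, hR⟩ := exists_lift_near hsurj
    have hev : ∀ᶠ y in 𝓝 (γ t), (WithLp.toLp 2 (t, y) : TE n) ∈ U ∧
        Function.Surjective (fderiv ℝ g (WithLp.toLp 2 (t, y)) ∘L spaceIncl n) := by
      have h1 : Tendsto (fun y => fderiv ℝ g (WithLp.toLp 2 (t, y)) ∘L spaceIncl n) (𝓝 (γ t))
          (𝓝 (fderiv ℝ g p ∘L spaceIncl n)) :=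
        tendsto_clm_comp ((hch.tendsto_fderiv hpU).comp (hcont.tendsto (γ t))) tendsto_const_nhds
      filter_upwards [hcont.continuousAt (hch.isOpen.mem_nhds hpU), h1.eventually hR]
        with y hy hy'
      exact ⟨hy, hy'.1⟩
    obtain ⟨V, hV, hVo, hxV⟩ := eventually_nhds_iff.1 hev
    have hsl : IsConicChart (S t) V (fun y : E n => g (WithLp.toLp 2 (t, y))) K :=
      { isOpen := hVo
        contDiffOn := by
          have hsm : ContDiff ℝ 1 fun y : E n => (WithLp.toLp 2 (t, y) : TE n) := by
            have : (fun y : E n => (WithLp.toLp 2 (t, y) : TE n)) =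
                fun y => WithLp.toLp 2 (t, (0 : E n)) + spaceIncl n y :=
              funext (toLp_eq_add t)
            rw [this]
            exact contDiff_const.add (spaceIncl n).contDiff
          exact hch.contDiffOn.comp hsm.contDiffOn fun y hy => (hV y hy).1
        surjective := fun y hy => by
          rw [(hder y (hV y hy).1).fderiv]
          exact (hV y hy).2
        closed := hch.closed
        add_mem := hch.add_mem
        smul_mem := hch.smul_mem
        pointed := hch.pointed
        mem_iff := fun y hy => hch.mem_iff _ (hV y hy).1 }
    refine frechet_subset_limiting hpC (hch.polarAt_subset_frechet hpU (h0 p hpU hf) ?_)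
    intro q hq
    have hqe : q = WithLp.toLp 2 (q.fst, q.snd) := rfl
    have h1 := hsl.limiting_subset_polarAt hxV hv (q.snd - q.fst • v) (by
      rw [(hder _ hpU).fderiv, ContinuousLinearMap.comp_apply, ← hp, ← hsplit]
      exact hq)
    rw [hqe, inner_toLp]
    rw [inner_sub_right, real_inner_smul_right, inner_neg_left v v,
      real_inner_self_eq_norm_sq] at h1
    linarith

lemma le_asymModulus {t : ℝ} {x u : E n} {α : ℝ} (hu : ‖u‖ ≤ 1)
    (hα : WithLp.toLp 2 (α, -u) ∈ limitingNormalCone (gph S) (WithLp.toLp 2 (t, x))) :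
    ENNReal.ofReal α ≤ asymModulus S t x :=
  le_iSup₂_of_le u hu (le_iSup₂_of_le α hα le_rfl)

lemma asymModulus_le {t : ℝ} {x : E n} {c : ℝ≥0∞}
    (h : ∀ u : E n, ‖u‖ ≤ 1 → ∀ α : ℝ,
      WithLp.toLp 2 (α, -u) ∈ limitingNormalCone (gph S) (WithLp.toLp 2 (t, x)) →
        ENNReal.ofReal α ≤ c) : asymModulus S t x ≤ c :=
  iSup₂_le fun u hu => iSup₂_le fun α hα => h u hu α hα

lemma exists_of_lt_asymModulus {t : ℝ} {x : E n} {c : ℝ≥0∞} (h : c < asymModulus S t x) :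
    ∃ u : E n, ‖u‖ ≤ 1 ∧ ∃ α : ℝ, c < ENNReal.ofReal α ∧
      WithLp.toLp 2 (α, -u) ∈ limitingNormalCone (gph S) (WithLp.toLp 2 (t, x)) := by
  by_contra! hcon
  exact h.not_ge (asymModulus_le fun u hu α hα => not_lt.1 fun hlt => hcon u hu α hlt hα)

/-- The speed of an orbit is at most the modulus of the coderivative. -/
lemma enorm_deriv_le_asymModulus (hC : ∀ p ∈ frontier (gph S), HasConicChart (gph S) p)
    {γ : ℝ → E n} {t : ℝ} (hγ : DifferentiableAt ℝ γ t) (hS : ∀ᶠ s in 𝓝 t, γ s ∈ S s)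
    (hv : -deriv γ t ∈ limitingNormalCone (S t) (γ t)) :
    ‖deriv γ t‖ₑ ≤ asymModulus S t (γ t) := by
  set v := deriv γ t with hvd
  have h1 := lift_normal hC hγ.hasDerivAt hS hv
  rw [← hvd] at h1
  rcases eq_or_ne v 0 with h0 | h0
  · simp [h0]
  have hn : 0 < ‖v‖ := norm_pos_iff.2 h0
  have h2 := smul_mem_limiting (inv_nonneg.2 hn.le) h1
  have h3 : (‖v‖⁻¹ • WithLp.toLp 2 (‖v‖ ^ 2, -v) : TE n) =
      WithLp.toLp 2 (‖v‖, -(‖v‖⁻¹ • v)) := by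
    rw [← WithLp.toLp_smul, Prod.smul_mk, smul_neg, smul_eq_mul]
    congr 2
    field_simp
  rw [h3] at h2
  rw [← ofReal_norm]
  refine le_asymModulus ?_ h2
  rw [norm_smul, norm_inv, norm_norm, inv_mul_cancel₀ hn.ne']

/-- The modulus of the coderivative is at most the speed of any differentiable selection. -/
lemma asymModulus_le_enorm_deriv (hC : ∀ p ∈ frontier (gph S), HasConicChart (gph S) p)
    {γ : ℝ → E n} {t : ℝ} (hγ : DifferentiableAt ℝ γ t) (hS : ∀ᶠ s in 𝓝 t, γ s ∈ S s) :
    asymModulus S t (γ t) ≤ ‖deriv γ t‖ₑ := by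
  refine asymModulus_le fun u hu α hα => ?_
  rw [← ofReal_norm]
  refine ENNReal.ofReal_le_ofReal ?_
  have hf := limiting_subset_frechet hC (mem_gph_toLp.2 hS.self_of_nhds) hα
  have hd := hasDerivAt_toLp hγ.hasDerivAt
  set v := deriv γ t with hv
  set c : ℝ → TE n := fun s => WithLp.toLp 2 (s, γ s) with hc
  -- the tangent `(1, v)` makes an obtuse angle with the normal
  have key : inner ℝ (WithLp.toLp 2 (α, -u) : TE n) (WithLp.toLp 2 ((1 : ℝ), v)) ≤ 0 := by
    refine le_of_forall_pos_le_add fun ε hε => ?_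
    rw [zero_add]
    set w : TE n := WithLp.toLp 2 ((1 : ℝ), v) with hw
    have hslope := (hasDerivAt_iff_tendsto_slope.1 hd).mono_left (nhdsGT_le_nhdsNE t)
    have hε' : 0 < ε / (‖w‖ + 1) := by positivity
    have hev : ∀ᶠ s in 𝓝[>] t, inner ℝ (WithLp.toLp 2 (α, -u) : TE n) (slope c t s) ≤
        ε / (‖w‖ + 1) * ‖slope c t s‖ := by
      have hct : Tendsto c (𝓝[>] t) (𝓝[gph S] (c t)) :=
        tendsto_nhdsWithin_iff.2 ⟨hd.continuousAt.tendsto.mono_left nhdsWithin_le_nhds,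
          hS.filter_mono nhdsWithin_le_nhds⟩
      filter_upwards [hct.eventually (hf _ hε'), self_mem_nhdsWithin] with s hs hst
      have hst' : 0 < (s - t)⁻¹ := inv_pos.2 (sub_pos.2 hst)
      rw [slope_def_module, real_inner_smul_right, norm_smul, Real.norm_of_nonneg hst'.le]
      have := mul_le_mul_of_nonneg_left hs hst'.le
      linarith
    have h1 := le_of_tendsto_of_tendsto (tendsto_const_nhds.inner hslope)
      (hslope.norm.const_mul (ε / (‖w‖ + 1))) hev
    refine h1.trans ?_
    rw [div_mul_eq_mul_div, div_le_iff₀ (by positivity)]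
    nlinarith [norm_nonneg w]
  rw [inner_toLp, inner_neg_left] at key
  have h2 := real_inner_le_norm u v
  have h3 : ‖u‖ * ‖v‖ ≤ 1 * ‖v‖ := by gcongr
  linarith

end Velocity

/-! ### Continuity of the oriented talweg -/

section Talweg

variable {n : ℕ} {S : ℝ → Set (E n)}

lemma asymModulus_eq_zero_of_interior {t : ℝ} {x : E n}
    (h : (WithLp.toLp 2 (t, x) : TE n) ∈ interior (gph S)) : asymModulus S t x = 0 := by
  refine le_antisymm (asymModulus_le fun u hu α hα => ?_) zero_le
  have h0 := limiting_eq_zero_of_interior h hα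
  have : α = 0 := congrArg WithLp.fst h0
  simp [this]

lemma mem_frontier_of_asymModulus_pos {t : ℝ} {x : E n} (hx : x ∈ S t) {c : ℝ≥0∞}
    (h : c < asymModulus S t x) : (WithLp.toLp 2 (t, x) : TE n) ∈ frontier (gph S) :=
  ⟨subset_closure (mem_gph_toLp.2 hx), fun hi => by
    rw [asymModulus_eq_zero_of_interior hi] at h
    exact not_lt_zero h⟩

/-- The modulus of the coderivative is upper semicontinuous. Normals whose time component is
large are rescaled, so that a horizontal normal in the limit causes no trouble. -/
lemma le_asymModulus_of_tendsto {c : ℝ} (hc : 0 < c) {p : ℕ → TE n} {p₀ : TE n}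
    (h : ∀ i, ENNReal.ofReal c < asymModulus S (p i).fst (p i).snd)
    (hp : Tendsto p atTop (𝓝 p₀)) : ENNReal.ofReal c ≤ asymModulus S p₀.fst p₀.snd := by
  have : ∀ i, ∃ u : E n, ‖u‖ ≤ 1 ∧
      (WithLp.toLp 2 (c, -u) : TE n) ∈ limitingNormalCone (gph S) (p i) := fun i => by
    obtain ⟨u, hu, α, hα, hN⟩ := exists_of_lt_asymModulus (h i)
    have hα' : c < α := (ENNReal.ofReal_lt_ofReal_iff_of_nonneg hc.le).1 hα
    have hα0 : 0 < α := hc.trans hα'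
    refine ⟨(c / α) • u, ?_, ?_⟩
    · rw [norm_smul, Real.norm_of_nonneg (by positivity)]
      exact mul_le_one₀ ((div_le_one hα0).2 hα'.le) (norm_nonneg u) hu
    · have h1 := smul_mem_limiting (r := c / α) (by positivity) hN
      have h2 : ((c / α) • WithLp.toLp 2 (α, -u) : TE n) = WithLp.toLp 2 (c, -((c / α) • u)) := by
        rw [← WithLp.toLp_smul, Prod.smul_mk, smul_neg, smul_eq_mul, div_mul_cancel₀ _ hα0.ne']
      rw [h2] at h1
      exact h1
  choose u hu hN using this
  obtain ⟨u₀, hu₀, φ, hφ, hlim⟩ := (isCompact_closedBall (0 : E n) 1).tendsto_subseq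
    (fun i => mem_closedBall_zero_iff.2 (hu i))
  refine le_asymModulus (mem_closedBall_zero_iff.1 hu₀)
    (mem_limiting_of_tendsto (fun i => hN (φ i)) (hp.comp hφ.tendsto_atTop) ?_)
  exact (continuous_toLp.tendsto (c, -u₀)).comp (tendsto_const_nhds.prodMk_nhds hlim.neg)

lemma continuous_fst_TE : Continuous fun q : TE n => q.fst :=
  continuous_fst.comp (WithLp.prodContinuousLinearEquiv 2 ℝ ℝ (E n)).continuous

lemma continuous_snd_TE : Continuous fun q : TE n => q.snd :=
  continuous_snd.comp (WithLp.prodContinuousLinearEquiv 2 ℝ ℝ (E n)).continuous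

/-- Along the boundary of the graph, the modulus of the coderivative is lower semicontinuous. -/
lemma eventually_lt_asymModulus (hcl : IsClosed (gph S))
    (hC : ∀ p ∈ frontier (gph S), HasConicChart (gph S) p) {p : TE n}
    (hp : p ∈ frontier (gph S)) {c : ℝ} (hc : 0 ≤ c)
    (h : ENNReal.ofReal c < asymModulus S p.fst p.snd) :
    ∀ᶠ q in 𝓝 p, q ∈ frontier (gph S) → ENNReal.ofReal c < asymModulus S q.fst q.snd := by
  obtain ⟨u, hu, α, hα, hN⟩ := exists_of_lt_asymModulus h
  have hα' : c < α := (ENNReal.ofReal_lt_ofReal_iff_of_nonneg hc).1 hα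
  obtain ⟨W, hW, hWN⟩ := exists_tendsto_limiting hcl hC hp hN
  have h1 : Tendsto (fun q => (W q).fst) (𝓝 p) (𝓝 α) :=
    (continuous_fst_TE.tendsto _).comp hW
  have h2 : Tendsto (fun q => max 1 ‖(W q).snd‖) (𝓝 p) (𝓝 1) := by
    have : Tendsto (fun q => max 1 ‖(W q).snd‖) (𝓝 p) (𝓝 (max 1 ‖-u‖)) :=
      tendsto_const_nhds.max ((continuous_snd_TE.tendsto _).comp hW).norm
    rwa [norm_neg, max_eq_left hu] at this
  have h3 : Tendsto (fun q => (max 1 ‖(W q).snd‖)⁻¹ * (W q).fst) (𝓝 p) (𝓝 α) := by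
    simpa using (h2.inv₀ one_ne_zero).mul h1
  filter_upwards [hWN, h3.eventually (lt_mem_nhds hα')] with q hq hqc hqf
  set r := max 1 ‖(W q).snd‖ with hr
  have hr1 : 1 ≤ r := le_max_left _ _
  have h4 := smul_mem_limiting (inv_nonneg.2 (zero_le_one.trans hr1)) (hq hqf)
  have h5 : r⁻¹ • W q = WithLp.toLp 2 (r⁻¹ * (W q).fst, -(-(r⁻¹ • (W q).snd))) := by
    rw [neg_neg]
    rfl
  rw [h5] at h4
  refine lt_of_lt_of_le ((ENNReal.ofReal_lt_ofReal_iff_of_nonneg hc).2 hqc)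
    (le_asymModulus ?_ h4)
  rw [norm_neg, norm_smul, norm_inv, Real.norm_of_nonneg (by linarith), inv_mul_le_one₀
    (by linarith)]
  exact le_max_right _ _

lemma isCompact_HS (hcl : IsClosed (gph S)) (hbdd : ∀ t : ℝ, Bornology.IsBounded (S t)) (t : ℝ) :
    IsCompact (HS S t) := by
  have hcont : Continuous fun y : E n => (WithLp.toLp 2 (t, y) : TE n) :=
    continuous_toLp.comp (by fun_prop)
  have hSt : IsCompact (S t) :=
    Metric.isCompact_of_isClosed_isBounded (hcl.preimage hcont) (hbdd t)
  refine (hSt.image hcont).of_isClosed_subset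
    (isClosed_frontier.inter (isClosed_singleton.preimage continuous_fst_TE)) ?_
  rintro q ⟨hq, rfl : q.fst = t⟩
  exact ⟨q.snd, hcl.frontier_subset hq, rfl⟩

lemma asymModulus_le_talweg {t : ℝ} {x : E n} (hx : x ∈ S t) :
    asymModulus S t x ≤ talweg S t :=
  le_iSup₂_of_le x hx le_rfl

lemma exists_of_lt_talweg {t : ℝ} {c : ℝ≥0∞} (h : c < talweg S t) :
    ∃ x ∈ S t, c < asymModulus S t x := by
  simpa [talweg, lt_iSup_iff] using h

/-- Points of sets that converge to a compact set for the Pompeiu-Hausdorff distance have a cluster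
point in the compact set. -/
lemma exists_subseq_tendsto_of_hausdorffEDist {X : Type*} [PseudoMetricSpace X] {H : ℕ → Set X}
    {K : Set X} (hK : IsCompact K)
    (hH : Tendsto (fun i => Metric.hausdorffEDist (H i) K) atTop (𝓝 0))
    {p : ℕ → X} (hp : ∀ i, p i ∈ H i) :
    ∃ y ∈ K, ∃ ψ : ℕ → ℕ, Tendsto (fun i => p (ψ i)) atTop (𝓝 y) := by
  have hlt : ∀ᶠ i in atTop, ∃ y ∈ K, edist (p i) y <
      Metric.hausdorffEDist (H i) K + ENNReal.ofReal (1 / ((i : ℝ) + 1)) := by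
    filter_upwards [hH.eventually (gt_mem_nhds one_pos)] with i hi
    refine Metric.exists_edist_lt_of_hausdorffEDist_lt (hp i) ?_
    refine ENNReal.lt_add_right (ne_top_of_lt hi) ?_
    rw [Ne, ENNReal.ofReal_eq_zero, not_le]
    positivity
  obtain ⟨N, hN⟩ := eventually_atTop.1 hlt
  choose y hyK hyd using fun i => hN (i + N) (Nat.le_add_left _ _)
  obtain ⟨y₀, hy₀, φ, hφ, hlim⟩ := hK.tendsto_subseq hyK
  have hsub : Tendsto (fun i => φ i + N) atTop atTop :=
    tendsto_atTop_mono (fun i => Nat.le_add_right (φ i) N) hφ.tendsto_atTop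
  refine ⟨y₀, hy₀, fun i => φ i + N, ?_⟩
  have h1 : Tendsto (fun i : ℕ => Metric.hausdorffEDist (H i) K +
      ENNReal.ofReal (1 / ((i : ℝ) + 1))) atTop (𝓝 0) := by
    have := hH.add (ENNReal.tendsto_ofReal tendsto_one_div_add_atTop_nhds_zero_nat)
    simpa using this
  have hd0 : Tendsto (fun i => edist (y (φ i)) (p (φ i + N))) atTop (𝓝 0) := by
    refine tendsto_of_tendsto_of_tendsto_of_le_of_le tendsto_const_nhds (h1.comp hsub)
      (fun _ => zero_le) (fun i => ?_)
    simp only [Function.comp_apply]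
    rw [edist_comm]
    exact (hyd _).le
  have hd1 : Tendsto (fun i => dist (y (φ i)) (p (φ i + N))) atTop (𝓝 0) := by
    simp only [dist_edist]
    exact (ENNReal.tendsto_toReal ENNReal.zero_ne_top).comp hd0
  exact (tendsto_iff_of_dist hd1).1 hlim

lemma eventually_talweg_le (hcl : IsClosed (gph S)) (hbdd : ∀ t : ℝ, Bornology.IsBounded (S t))
    {t : ℝ} (hH : Tendsto (fun s => Metric.hausdorffEDist (HS S s) (HS S t)) (𝓝 t) (𝓝 0))
    {c : ℝ} (hc : 0 < c) (h : talweg S t < ENNReal.ofReal c) :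
    ∀ᶠ s in 𝓝 t, talweg S s ≤ ENNReal.ofReal c := by
  by_contra hcon
  simp only [not_eventually, not_le] at hcon
  obtain ⟨s, hs, hsc⟩ := exists_seq_forall_of_frequently hcon
  choose x hx hxc using fun i => exists_of_lt_talweg (hsc i)
  have hpH : ∀ i, (WithLp.toLp 2 (s i, x i) : TE n) ∈ HS S (s i) := fun i =>
    ⟨mem_frontier_of_asymModulus_pos (hx i) (hxc i), rfl⟩
  obtain ⟨y₀, hy₀, ψ, hψ⟩ := exists_subseq_tendsto_of_hausdorffEDist (isCompact_HS hcl hbdd t)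
    (hH.comp hs) hpH
  have h1 := le_asymModulus_of_tendsto (S := S) hc
    (p := fun i => WithLp.toLp 2 (s (ψ i), x (ψ i))) (fun i => hxc (ψ i)) hψ
  have h2 : y₀.fst = t := hy₀.2
  have hm : y₀.snd ∈ S y₀.fst := hcl.frontier_subset hy₀.1
  rw [h2] at h1 hm
  exact (h1.trans (asymModulus_le_talweg hm)).not_gt h

lemma eventually_lt_talweg (hcl : IsClosed (gph S))
    (hC : ∀ p ∈ frontier (gph S), HasConicChart (gph S) p)
    {t : ℝ} (hH : Tendsto (fun s => Metric.hausdorffEDist (HS S s) (HS S t)) (𝓝 t) (𝓝 0))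
    {c : ℝ} (hc : 0 ≤ c) (h : ENNReal.ofReal c < talweg S t) :
    ∀ᶠ s in 𝓝 t, ENNReal.ofReal c < talweg S s := by
  obtain ⟨x, hx, hxc⟩ := exists_of_lt_talweg h
  have hf := mem_frontier_of_asymModulus_pos hx hxc
  obtain ⟨r, hr, hball⟩ := Metric.nhds_basis_eball.mem_iff.1
    (eventually_lt_asymModulus hcl hC hf hc hxc)
  filter_upwards [hH.eventually (gt_mem_nhds hr)] with s hs
  rw [Metric.hausdorffEDist_comm] at hs
  obtain ⟨q, hq, hqd⟩ := Metric.exists_edist_lt_of_hausdorffEDist_lt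
    (show (WithLp.toLp 2 (t, x) : TE n) ∈ HS S t from ⟨hf, rfl⟩) hs
  have h1 := hball (by rwa [Metric.mem_eball, edist_comm]) hq.1
  have h2 : q.fst = s := hq.2
  have hm : q.snd ∈ S q.fst := hcl.frontier_subset hq.1
  rw [h2] at h1 hm
  exact h1.trans_le (asymModulus_le_talweg hm)

/-- The talweg is continuous at the times at which it is finite and the boundary of the graph
varies continuously. -/
lemma continuousAt_talweg (hcl : IsClosed (gph S))
    (hC : ∀ p ∈ frontier (gph S), HasConicChart (gph S) p)
    (hbdd : ∀ t : ℝ, Bornology.IsBounded (S t))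
    {t : ℝ} (hH : Tendsto (fun s => Metric.hausdorffEDist (HS S s) (HS S t)) (𝓝 t) (𝓝 0)) :
    ContinuousAt (talweg S) t := by
  refine tendsto_order.2 ⟨fun c hc => ?_, fun c hc => ?_⟩
  · have hct : c ≠ ⊤ := ne_top_of_lt hc
    rw [← ENNReal.ofReal_toReal hct] at hc ⊢
    exact eventually_lt_talweg hcl hC hH ENNReal.toReal_nonneg hc
  · obtain ⟨d, hd1, hd2⟩ := exists_between hc
    have hdt : d ≠ ⊤ := ne_top_of_lt hd2
    have hd0 : 0 < d.toReal := ENNReal.toReal_pos (ne_bot_of_gt hd1) hdt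
    rw [← ENNReal.ofReal_toReal hdt] at hd1 hd2
    filter_upwards [eventually_talweg_le hcl hbdd hH hd0 hd1] with s hs
    exact hs.trans_lt hd2

end Talweg

/-! ### Local orbits of nearly maximal speed -/

section LocalOrbit

variable {n : ℕ} {S : ℝ → Set (E n)}

lemma AC.mono {I J : Set ℝ} (hJ : J ⊆ I) {γ : ℝ → E n} (h : γ ∈ AC S I) : γ ∈ AC S J :=
  ⟨fun c d hcd hs => h.1 c d hcd (hs.trans hJ), fun t ht => h.2.1 t (hJ ht),
    ae_restrict_of_ae_restrict_of_subset hJ h.2.2⟩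

/-- An orbit that starts where the modulus of the coderivative exceeds `c ≥ 0` keeps this property
for some time: the modulus is lower semicontinuous along the boundary of the graph, and the orbit
cannot leave the boundary. If it left the boundary, it would rest from then on, so that the
graph would contain a horizontal segment to the right of a boundary point `p`; this forces all
normals at `p` to have nonpositive time components. -/
lemma exists_lt_asymModulus_along_orbit (hcl : IsClosed (gph S))
    (hC : ∀ p ∈ frontier (gph S), HasConicChart (gph S) p) {t δ c : ℝ} (hδ : 0 < δ)
    (hc : 0 ≤ c) {γ : ℝ → E n} (hγ : γ ∈ AC S (Ico t (t + δ)))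
    (h : ENNReal.ofReal c < asymModulus S t (γ t)) :
    ∃ e, t < e ∧ e ≤ t + δ ∧ ∀ s ∈ Ico t e, ENNReal.ofReal c < asymModulus S s (γ s) := by
  set p : ℝ → TE n := fun s => WithLp.toLp 2 (s, γ s) with hp
  have hpt : p t ∈ frontier (gph S) :=
    mem_frontier_of_asymModulus_pos (hγ.2.1 t ⟨le_rfl, by linarith⟩) h
  have hcont : ∀ d, d < t + δ → ContinuousOn p (Icc t d) := fun d hd => by
    rcases lt_or_ge d t with hdt | hdt
    · simp [Icc_eq_empty_of_lt hdt]
    have h1 := (hγ.1 t d hdt (fun s hs => ⟨hs.1, hs.2.trans_lt hd⟩)).continuousOn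
    rw [uIcc_of_le hdt] at h1
    exact continuous_toLp.comp_continuousOn (continuousOn_id.prodMk h1)
  have hV := eventually_lt_asymModulus hcl hC hpt hc h
  have hev : ∀ᶠ s in 𝓝[≥] t, p s ∈ frontier (gph S) → ENNReal.ofReal c < asymModulus S s (γ s) := by
    have h1 : Tendsto p (𝓝[≥] t) (𝓝 (p t)) := by
      have := (hcont (t + δ / 2) (by linarith)) t ⟨le_rfl, by linarith⟩
      rwa [ContinuousWithinAt, nhdsWithin_Icc_eq_nhdsGE (by linarith)] at this
    exact h1.eventually hV
  obtain ⟨e', he', hes⟩ := (mem_nhdsGE_iff_exists_Ico_subset' (show t < t + δ by linarith)).1 hev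
  refine ⟨min e' (t + δ), lt_min he' (by linarith), min_le_right _ _, fun s₁ hs₁ => ?_⟩
  have hs₁e : s₁ < e' := hs₁.2.trans_le (min_le_left _ _)
  have hs₁δ : s₁ < t + δ := hs₁.2.trans_le (min_le_right _ _)
  refine hes ⟨hs₁.1, hs₁e⟩ ?_
  by_contra hnf
  have hmem : ∀ s ∈ Icc t s₁, p s ∈ gph S := fun s hs => hγ.2.1 s ⟨hs.1, hs.2.trans_lt hs₁δ⟩
  set Z : Set ℝ := Icc t s₁ ∩ p ⁻¹' frontier (gph S) with hZ
  have hZc : IsCompact Z := isCompact_Icc.of_isClosed_subset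
    ((hcont s₁ hs₁δ).preimage_isClosed_of_isClosed isClosed_Icc isClosed_frontier) inter_subset_left
  obtain ⟨s₀, hs₀Z, hs₀max⟩ := hZc.exists_isGreatest ⟨t, ⟨le_rfl, hs₁.1⟩, hpt⟩
  have hs₀1 : s₀ < s₁ := lt_of_le_of_ne hs₀Z.1.2 (fun heq => hnf (heq ▸ hs₀Z.2))
  have hint : ∀ s ∈ Ioc s₀ s₁, p s ∈ interior (gph S) := fun s hs => by
    by_contra hsi
    have hst : s ∈ Icc t s₁ := ⟨hs₀Z.1.1.trans hs.1.le, hs.2⟩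
    exact (hs₀max ⟨hst, subset_closure (hmem s hst), hsi⟩).not_gt hs.1
  have hconst : ∀ s ∈ Icc s₀ s₁, γ s = γ s₀ := by
    have hAC := hγ.1 s₀ s₁ hs₀1.le (fun s hs => ⟨hs₀Z.1.1.trans hs.1, hs.2.trans_lt hs₁δ⟩)
    obtain ⟨C, hCc⟩ := hAC.const_of_ae_hasDerivAt_zero (by
      have h1 := (ae_restrict_iff' measurableSet_Ico).1 hγ.2.2
      have h2 : ∀ᵐ s : ℝ, s ≠ s₀ := by
        simp [ae_iff]
      filter_upwards [h1, h2] with s hs hs0 hsI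
      rw [uIcc_of_le hs₀1.le] at hsI
      obtain ⟨hd, hN⟩ := hs ⟨hs₀Z.1.1.trans hsI.1, hsI.2.trans_lt hs₁δ⟩
      have h3 := limiting_eq_zero_of_interior (mem_interior_slice
        (hint s ⟨lt_of_le_of_ne hsI.1 (Ne.symm hs0), hsI.2⟩)) hN
      have h4 := hd.hasDerivAt
      rwa [neg_eq_zero.1 h3] at h4)
    rw [uIcc_of_le hs₀1.le] at hCc
    intro s hs
    rw [hCc s hs, hCc s₀ ⟨le_rfl, hs₀1.le⟩]
  have hs₀c := hes ⟨hs₀Z.1.1, hs₀1.trans hs₁e⟩ hs₀Z.2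
  obtain ⟨u, -, α, hα, hN⟩ := exists_of_lt_asymModulus hs₀c
  have hα0 : 0 < α := ENNReal.ofReal_pos.1 (zero_le.trans_lt hα)
  have hfr := limiting_subset_frechet hC (hmem s₀ hs₀Z.1) hN (α / 2) (by positivity)
  have htend : Tendsto (fun s => (WithLp.toLp 2 (s, γ s₀) : TE n)) (𝓝[>] s₀)
      (𝓝[gph S] (p s₀)) := by
    refine tendsto_nhdsWithin_iff.2 ⟨?_, ?_⟩
    · have : Continuous fun s : ℝ => (WithLp.toLp 2 (s, γ s₀) : TE n) :=
        continuous_toLp.comp (by fun_prop)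
      exact (this.tendsto s₀).mono_left nhdsWithin_le_nhds
    · filter_upwards [Ioc_mem_nhdsGT hs₀1] with s hs
      rw [← hconst s ⟨hs.1.le, hs.2⟩]
      exact hmem s ⟨hs₀Z.1.1.trans hs.1.le, hs.2⟩
  obtain ⟨s, hs, hss⟩ := ((htend.eventually hfr).and self_mem_nhdsWithin).exists
  have hss : s₀ < s := hss
  have hdiff : (WithLp.toLp 2 (s, γ s₀) : TE n) - p s₀ = WithLp.toLp 2 (s - s₀, (0 : E n)) := by
    rw [hp, ← WithLp.toLp_sub]
    simp
  have hpos : 0 < s - s₀ := sub_pos.2 hss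
  rw [hdiff, inner_toLp, inner_zero_right, WithLp.norm_toLp_fst, Real.norm_of_nonneg hpos.le] at hs
  nlinarith

/-- Just after a time of continuity of the talweg, some orbit has a speed that is at least the
talweg minus one: it starts at a point at which the talweg is nearly attained. -/
lemma exists_fast_orbit (hcl : IsClosed (gph S))
    (hC : ∀ p ∈ frontier (gph S), HasConicChart (gph S) p) (hA1 : ExistenceAssumption S) {t : ℝ}
    (ht : t ∈ dom S) (hfin : talweg S t < ∞) (hcont : ContinuousAt (talweg S) t) :
    ∃ e, t < e ∧ ∃ γ ∈ AC S (Ico t e), ∀ s ∈ Ioo t e, DifferentiableAt ℝ γ s →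
      talweg S s ≤ ‖deriv γ s‖ₑ + 1 := by
  have hup : ∀ c : ℝ≥0∞, talweg S t < c → ∃ e, t < e ∧ ∀ s ∈ Ico t e, talweg S s < c :=
    fun c hc => by
      have h1 : ∀ᶠ s in 𝓝[≥] t, talweg S s < c :=
        (hcont.eventually (gt_mem_nhds hc)).filter_mono nhdsWithin_le_nhds
      obtain ⟨e, he, hes⟩ := (mem_nhdsGE_iff_exists_Ico_subset' (show t < t + 1 by linarith)).1 h1
      exact ⟨e, he, fun s hs => hes hs⟩
  rcases lt_or_ge (talweg S t) 1 with hlt | hge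
  · obtain ⟨x, hx⟩ := ht
    obtain ⟨δ, hδ, γ, hγ, -⟩ := hA1 t x hx ((asymModulus_le_talweg hx).trans_lt hfin)
    obtain ⟨e, he, hes⟩ := hup 1 hlt
    refine ⟨min e (t + δ), lt_min he (by linarith), γ,
      AC.mono (Ico_subset_Ico_right (min_le_right _ _)) hγ, fun s hs _ => ?_⟩
    exact (hes s ⟨hs.1.le, hs.2.trans_le (min_le_left _ _)⟩).le.trans le_add_self
  · set c : ℝ := (talweg S t).toReal - 1 / 2 with hcdef
    have h1 : 1 ≤ (talweg S t).toReal := by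
      have := ENNReal.toReal_mono hfin.ne hge
      simpa using this
    have hc : 0 ≤ c := by linarith
    have hct : ENNReal.ofReal c < talweg S t := by
      rw [ENNReal.ofReal_lt_iff_lt_toReal hc hfin.ne]
      linarith
    have hct' : talweg S t < ENNReal.ofReal c + 1 := by
      rw [← ENNReal.ofReal_one, ← ENNReal.ofReal_add hc zero_le_one,
        ← ENNReal.ofReal_toReal hfin.ne, ENNReal.ofReal_lt_ofReal_iff (by linarith)]
      linarith
    obtain ⟨x, hx, hxc⟩ := exists_of_lt_talweg hct
    obtain ⟨δ, hδ, γ, hγ, rfl⟩ := hA1 t x hx ((asymModulus_le_talweg hx).trans_lt hfin)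
    obtain ⟨e, he, heδ, hes⟩ := exists_lt_asymModulus_along_orbit hcl hC hδ hc hγ hxc
    obtain ⟨e', he', hes'⟩ := hup _ hct'
    refine ⟨min e e', lt_min he he', γ, AC.mono (Ico_subset_Ico_right
      ((min_le_left _ _).trans heδ)) hγ, fun s hs hd => ?_⟩
    have h2 := hes s ⟨hs.1.le, hs.2.trans_le (min_le_left _ _)⟩
    have h3 := hes' s ⟨hs.1.le, hs.2.trans_le (min_le_right _ _)⟩
    refine h3.le.trans (add_le_add_left (h2.le.trans (asymModulus_le_enorm_deriv hC hd ?_)) 1)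
    filter_upwards [Ioo_mem_nhds hs.1 (hs.2.trans_le (min_le_left _ _))] with r hr
    exact hγ.2.1 r ⟨hr.1.le, hr.2.trans_le heδ⟩

end LocalOrbit

/-! ### Gluing local orbits -/

section Gluing

variable {n : ℕ} {S : ℝ → Set (E n)}

lemma absolutelyContinuousOnInterval_congr {X : Type*} [PseudoMetricSpace X] {f g : ℝ → X}
    {c d : ℝ} (hcd : c ≤ d) (hf : AbsolutelyContinuousOnInterval f c d)
    (h : ∀ s ∈ Icc c d, g s = f s) : AbsolutelyContinuousOnInterval g c d := by
  rw [absolutelyContinuousOnInterval_iff] at hf ⊢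
  intro ε hε
  obtain ⟨δ, hδ, hE⟩ := hf ε hε
  refine ⟨δ, hδ, fun P hP hlen => ?_⟩
  have h1 := hE P hP hlen
  rw [← uIcc_of_le hcd] at h
  rwa [Finset.sum_congr rfl fun i hi => by rw [h _ (hP.1 i hi).1, h _ (hP.1 i hi).2]]

lemma PAC.mono {I J : Set ℝ} (hJ : J ⊆ I) {γ : ℝ → E n} (h : γ ∈ PAC S I) : γ ∈ PAC S J := by
  obtain ⟨⟨D, hD, hDc, hAC⟩, hsel, hae⟩ := h
  exact ⟨⟨D, hD, hDc, fun c d hcd hs => hAC c d hcd (hs.trans (sdiff_subset_sdiff_left hJ))⟩,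
    fun t ht => hsel t (hJ ht), ae_restrict_of_ae_restrict_of_subset hJ hae⟩

/-- If an orbit starts at every time in `(a, b')`, then countably many of them can be glued to a
piecewise absolutely continuous orbit on `(a, b')`, continued by a given `γ₀`. The local orbits
live on open intervals `J` whose union misses only countably many times, as a missed time is
isolated on the right among the missed times. Enumerate countably many of the intervals with the
same union, and follow at each time the local orbit of smallest available index; the exceptional
set `D` consists of the times near which this index is not constant. -/
lemma exists_glued_orbit {a b' b : ℝ} (hab : a < b') {γ₀ : ℝ → E n}
    (h₀ : ∀ t ∈ Icc a b, γ₀ t ∈ S t) (hγ₀ : γ₀ ∈ PAC S (Icc b' b)) {P : ℝ → E n → Prop}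
    (hloc : ∀ t ∈ Ioo a b', ∃ e, t < e ∧ ∃ η ∈ AC S (Ico t e), ∀ s ∈ Ioo t e,
      DifferentiableAt ℝ η s → P s (deriv η s)) :
    ∃ γ ∈ PAC S (Icc a b), ∀ᵐ s ∂(volume.restrict (Ioo a b')), P s (deriv γ s) := by
  classical
  choose! e he η hη hP using hloc
  set J : ℝ → Set ℝ := fun t => Ioo t (min (e t) b') with hJ
  have hJe : ∀ t, J t ⊆ Ioo t (e t) := fun t => Ioo_subset_Ioo_right (min_le_left _ _)
  obtain ⟨T, hTsub, hTc, hTU⟩ : ∃ T ⊆ Ioo a b', T.Countable ∧ ⋃ t ∈ T, J t = ⋃ t ∈ Ioo a b', J t :=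
    TopologicalSpace.isOpen_biUnion_countable _ _ fun _ _ => isOpen_Ioo
  set O : Set ℝ := ⋃ t ∈ Ioo a b', J t with hO
  have hJO : ∀ t ∈ Ioo a b', J t ⊆ O := fun t ht => subset_biUnion_of_mem (u := J) ht
  have hOsub : O ⊆ Ioo a b' := by
    refine iUnion₂_subset fun t ht s hs => ?_
    exact ⟨ht.1.trans hs.1, hs.2.trans_le (min_le_right _ _)⟩
  have hTne : T.Nonempty := by
    have hm : (a + b') / 2 ∈ Ioo a b' := ⟨by linarith, by linarith⟩
    have hne : (J ((a + b') / 2)).Nonempty := nonempty_Ioo.2 (lt_min (he _ hm) hm.2)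
    obtain ⟨s, hs⟩ := hne
    have : s ∈ ⋃ t ∈ T, J t := hTU ▸ hJO _ hm hs
    obtain ⟨t, ht, -⟩ := mem_iUnion₂.1 this
    exact ⟨t, ht⟩
  obtain ⟨f, hf⟩ := hTc.exists_eq_range hTne
  have hfm : ∀ i, f i ∈ Ioo a b' := fun i => hTsub (hf ▸ mem_range_self i)
  have hOf : ∀ s ∈ O, ∃ i, s ∈ J (f i) := fun s hs => by
    rw [← hTU, hf] at hs
    simpa using hs
  set idx : ℝ → ℕ := fun s => sInf {i | s ∈ J (f i)} with hidx
  have hidxm : ∀ s ∈ O, s ∈ J (f (idx s)) := fun s hs => Nat.sInf_mem (hOf s hs)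
  set γ : ℝ → E n := fun s => if s ∈ O then η (f (idx s)) s else γ₀ s with hγ
  set V : Set ℝ := {s | ∃ i, ∀ᶠ r in 𝓝 s, r ∈ J (f i) ∧ idx r = i} with hV
  have hVidx : ∀ s ∈ V, ∀ᶠ r in 𝓝 s, r ∈ J (f (idx s)) ∧ idx r = idx s := by
    rintro s ⟨i, hi⟩
    rwa [hi.self_of_nhds.2]
  have hVm : ∀ s ∈ V, s ∈ J (f (idx s)) := fun s hs => (hVidx s hs).self_of_nhds.1
  have hVo : IsOpen V := by
    rw [isOpen_iff_mem_nhds]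
    rintro s ⟨i, hi⟩
    filter_upwards [eventually_eventually_nhds.2 hi] with r hr
    exact ⟨i, hr⟩
  have hVO : V ⊆ O := fun s hs => hJO _ (hfm _) (hVm s hs)
  have hγV : ∀ s ∈ V, γ =ᶠ[𝓝 s] η (f (idx s)) := fun s hs => by
    filter_upwards [hVidx s hs] with r hr
    rw [hγ]
    simp only [if_pos (hJO _ (hfm _) hr.1), hr.2]
  have hcount : (Icc a b' \ V).Countable := by
    have h1 : (Ioo a b' \ O).Countable := by
      refine (countable_setOfPred_isolated_right_within (s := Ioo a b' \ O)).mono fun x hx => ?_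
      refine ⟨hx, empty_mem_iff_bot.1 (mem_nhdsWithin.2 ⟨Iio (min (e x) b'), isOpen_Iio,
        lt_min (he x hx.1) hx.1.2, ?_⟩)⟩
      rintro y ⟨hy1, hy2, hy3⟩
      exact hy2.2 (hJO x hx.1 ⟨hy3, hy1⟩)
    refine (((Set.countable_insert.2 (countable_singleton b')).mono
      (subset_refl ({a, b'} : Set ℝ))).union (h1.union ((countable_range f).union
        (countable_range fun i => min (e (f i)) b')))).mono ?_
    rintro s ⟨hs, hsV⟩
    by_contra hcon
    simp only [mem_union, mem_insert_iff, mem_singleton_iff, not_or, mem_range, not_exists] at hcon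
    obtain ⟨⟨hsa, hsb⟩, hsO, hsf, hse⟩ := hcon
    have hsI : s ∈ Ioo a b' := ⟨lt_of_le_of_ne hs.1 (Ne.symm hsa), lt_of_le_of_ne hs.2 hsb⟩
    have hsO' : s ∈ O := by
      by_contra h
      exact hsO ⟨hsI, h⟩
    refine hsV ⟨idx s, ?_⟩
    have hlt : ∀ᶠ r in 𝓝 s, ∀ j ∈ Finset.range (idx s), r ∉ J (f j) := by
      rw [Filter.eventually_all_finset]
      intro j hj
      have hjs : s ∉ J (f j) := fun h => (Nat.sInf_le h).not_gt (Finset.mem_range.1 hj)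
      have hcl : s ∉ Icc (f j) (min (e (f j)) b') := fun h =>
        hjs ⟨lt_of_le_of_ne h.1 (hsf j), lt_of_le_of_ne h.2 (Ne.symm (hse j))⟩
      filter_upwards [isClosed_Icc.isOpen_compl.mem_nhds hcl] with r hr hrJ
      exact hr (Ioo_subset_Icc_self hrJ)
    filter_upwards [hlt, isOpen_Ioo.mem_nhds (hidxm s hsO')] with r hr hrJ
    refine ⟨hrJ, le_antisymm (Nat.sInf_le hrJ) ?_⟩
    by_contra! hlt'
    exact hr (idx r) (Finset.mem_range.2 hlt') (hidxm r (hJO _ (hfm _) hrJ))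
  have hnull : ∀ᵐ s : ℝ, s ∉ Icc a b' \ V := measure_eq_zero_iff_ae_notMem.1 (hcount.measure_zero _)
  have hηae : ∀ᵐ s : ℝ, ∀ i, s ∈ Ico (f i) (e (f i)) → DifferentiableAt ℝ (η (f i)) s ∧
      -deriv (η (f i)) s ∈ limitingNormalCone (S s) (η (f i) s) :=
    ae_all_iff.2 fun i => (ae_restrict_iff' measurableSet_Ico).1 (hη _ (hfm i)).2.2
  have hJIco : ∀ t, J t ⊆ Ico t (e t) := fun t => (hJe t).trans Ioo_subset_Ico_self
  obtain ⟨⟨D₀, hD₀, hD₀c, hAC₀⟩, -, hae₀⟩ := hγ₀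
  refine ⟨γ, ⟨⟨(Icc a b' \ V) ∪ D₀, (isClosed_Icc.sdiff hVo).union hD₀, hcount.union hD₀c, ?_⟩,
    ?_, ?_⟩, ?_⟩
  · intro c d hcd hs
    have hbV : b' ∉ V := fun h => lt_irrefl b' (hOsub (hVO h)).2
    have hbcd : b' ∉ Icc c d := fun h => (hs h).2 (Or.inl ⟨⟨hab.le, le_rfl⟩, hbV⟩)
    rcases le_or_gt b' c with hbc | hbc
    · refine absolutelyContinuousOnInterval_congr hcd (hAC₀ c d hcd fun s hsc =>
        ⟨⟨hbc.trans hsc.1, (hs hsc).1.2⟩, fun h => (hs hsc).2 (Or.inr h)⟩) fun s hsc => ?_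
      have : s ∉ O := fun h => (hOsub h).2.not_ge (hbc.trans hsc.1)
      simp only [hγ, if_neg this]
    · have hdb : d < b' := not_le.1 fun h => hbcd ⟨hbc.le, h⟩
      have hsV : Icc c d ⊆ V := fun s hsc => by
        by_contra h
        exact (hs hsc).2 (Or.inl ⟨⟨(hs hsc).1.1, hsc.2.trans hdb.le⟩, h⟩)
      have hcont : ContinuousOn idx (Icc c d) := fun s hsc => by
        have : idx =ᶠ[𝓝 s] fun _ => idx s := by
          filter_upwards [hVidx s (hsV hsc)] with r hr
          exact hr.2
        exact (continuousAt_const.congr this.symm).continuousWithinAt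
      have hconst : ∀ s ∈ Icc c d, idx s = idx c := fun s hsc =>
        isPreconnected_Icc.constant hcont hsc ⟨le_rfl, hcd⟩
      have hin : Icc c d ⊆ J (f (idx c)) := fun s hsc => hconst s hsc ▸ hVm s (hsV hsc)
      refine absolutelyContinuousOnInterval_congr hcd ((hη _ (hfm (idx c))).1 c d hcd
        (hin.trans (hJIco _))) fun s hsc => ?_
      simp only [hγ, if_pos (hVO (hsV hsc)), hconst s hsc]
  · intro t ht
    by_cases htO : t ∈ O
    · simp only [hγ, if_pos htO]
      exact (hη _ (hfm _)).2.1 t (hJIco _ (hidxm t htO))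
    · simp only [hγ, if_neg htO]
      exact h₀ t ht
  · rw [ae_restrict_iff' measurableSet_Icc]
    filter_upwards [hnull, hηae, (ae_restrict_iff' measurableSet_Icc).1 hae₀] with s hs1 hs2 hs3 hs
    rcases le_or_gt s b' with hsb | hsb
    · have hsV : s ∈ V := by
        by_contra h
        exact hs1 ⟨⟨hs.1, hsb⟩, h⟩
      obtain ⟨hd, hN⟩ := hs2 (idx s) (hJIco _ (hVm s hsV))
      have hev := hγV s hsV
      rw [hev.deriv_eq, hev.eq_of_nhds]
      exact ⟨hd.congr_of_eventuallyEq hev, hN⟩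
    · obtain ⟨hd, hN⟩ := hs3 ⟨hsb.le, hs.2⟩
      have hev : γ =ᶠ[𝓝 s] γ₀ := by
        filter_upwards [isOpen_Ioi.mem_nhds hsb] with r hr
        have : r ∉ O := fun h => (hOsub h).2.not_gt hr
        simp only [hγ, if_neg this]
      rw [hev.deriv_eq, hev.eq_of_nhds]
      exact ⟨hd.congr_of_eventuallyEq hev, hN⟩
  · rw [ae_restrict_iff' measurableSet_Ioo]
    filter_upwards [hnull, hηae] with s hs1 hs2 hs
    have hsV : s ∈ V := by
      by_contra h
      exact hs1 ⟨Ioo_subset_Icc_self hs, h⟩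
    rw [(hγV s hsV).deriv_eq]
    exact hP _ (hfm _) s (hJe _ (hVm s hsV)) (hs2 (idx s) (hJIco _ (hVm s hsV))).1

end Gluing

/-! ### Changes of time -/

section TimeChange

variable {F₁ F₂ : Type*} [NormedAddCommGroup F₁] [InnerProductSpace ℝ F₁] [NormedAddCommGroup F₂]
  [InnerProductSpace ℝ F₂]

/-- Fréchet normals are pulled back by the transpose of the derivative. -/
lemma mem_frechet_of_hasFDerivAt {C₁ : Set F₁} {C₂ : Set F₂} {T : F₂ → F₁} {L : F₂ →L[ℝ] F₁}
    {q : F₂} (hT : HasFDerivAt T L q) (hC : ∀ᶠ y in 𝓝 q, y ∈ C₂ → T y ∈ C₁)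
    {w₁ : F₁} {w₂ : F₂} (hw : ∀ v, inner ℝ w₂ v = inner ℝ w₁ (L v))
    (h : w₁ ∈ frechetNormalCone C₁ (T q)) : w₂ ∈ frechetNormalCone C₂ q := by
  intro ε hε
  have hε1 : 0 < ε / (2 * (‖L‖ + 1)) := by positivity
  have hε2 : 0 < min 1 (ε / (2 * (‖w₁‖ + 1))) := by positivity
  have hcont : Tendsto T (𝓝[C₂] q) (𝓝[C₁] (T q)) :=
    tendsto_nhdsWithin_iff.2 ⟨hT.continuousAt.tendsto.mono_left nhdsWithin_le_nhds,
      eventually_nhdsWithin_iff.2 hC⟩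
  filter_upwards [hcont.eventually (h _ hε1),
    (hT.isLittleO.bound hε2).filter_mono nhdsWithin_le_nhds] with y hy1 hy2
  set r := T y - T q - L (y - q) with hr
  have e1 : L (y - q) = (T y - T q) - r := by rw [hr]; abel
  have h1 : ‖T y - T q‖ ≤ (‖L‖ + 1) * ‖y - q‖ := by
    have : T y - T q = L (y - q) + r := by rw [hr]; abel
    rw [this]
    refine (norm_add_le _ _).trans ?_
    have := L.le_opNorm (y - q)
    have : min 1 (ε / (2 * (‖w₁‖ + 1))) * ‖y - q‖ ≤ 1 * ‖y - q‖ := by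
      gcongr
      exact min_le_left _ _
    linarith
  have h2 : ‖w₁‖ * ‖r‖ ≤ ε / 2 * ‖y - q‖ := by
    have : ‖r‖ ≤ ε / (2 * (‖w₁‖ + 1)) * ‖y - q‖ := hy2.trans (by
      gcongr
      exact min_le_right _ _)
    calc ‖w₁‖ * ‖r‖ ≤ (‖w₁‖ + 1) * (ε / (2 * (‖w₁‖ + 1)) * ‖y - q‖) := by
          gcongr
          linarith
      _ = ε / 2 * ‖y - q‖ := by field_simp
  have h3 : ε / (2 * (‖L‖ + 1)) * ‖T y - T q‖ ≤ ε / 2 * ‖y - q‖ := by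
    calc ε / (2 * (‖L‖ + 1)) * ‖T y - T q‖
        ≤ ε / (2 * (‖L‖ + 1)) * ((‖L‖ + 1) * ‖y - q‖) := by gcongr
      _ = ε / 2 * ‖y - q‖ := by field_simp
  rw [hw, e1, inner_sub_right]
  have h4 := neg_le_of_abs_le (abs_real_inner_le_norm w₁ r)
  linarith

variable {n : ℕ}

lemma hasFDerivAt_timeMap {Φ : ℝ → ℝ} {r φ' : ℝ} (h : HasDerivAt Φ φ' r) (x : E n) :
    ∃ L : TE n →L[ℝ] TE n, (∀ v, L v = WithLp.toLp 2 (φ' * v.fst, v.snd)) ∧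
      HasFDerivAt (fun q : TE n => (WithLp.toLp 2 (Φ q.fst, q.snd) : TE n)) L
        (WithLp.toLp 2 (r, x)) := by
  let e := WithLp.prodContinuousLinearEquiv 2 ℝ ℝ (E n)
  let A : (ℝ × E n) →L[ℝ] TE n := (e.symm : (ℝ × E n) →L[ℝ] TE n)
  let B : TE n →L[ℝ] ℝ × E n := (e : TE n →L[ℝ] ℝ × E n)
  have h1 : HasFDerivAt (fun z : ℝ × E n => (Φ z.1, z.2))
      (((ContinuousLinearMap.toSpanSingleton ℝ φ').comp
        (ContinuousLinearMap.fst ℝ ℝ (E n))).prod (ContinuousLinearMap.snd ℝ ℝ (E n))) (r, x) :=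
    (HasFDerivAt.comp (r, x) (f := Prod.fst) (g := Φ) h.hasFDerivAt hasFDerivAt_fst).prodMk
      hasFDerivAt_snd
  have h2 : HasFDerivAt (fun q : TE n => B q) B (WithLp.toLp 2 (r, x)) := B.hasFDerivAt
  refine ⟨_, fun v => ?_, (A.hasFDerivAt).comp (WithLp.toLp 2 (r, x) : TE n)
    (HasFDerivAt.comp (WithLp.toLp 2 (r, x) : TE n) (g := fun z : ℝ × E n => (Φ z.1, z.2)) h1 h2)⟩
  change WithLp.toLp 2 (v.fst • φ', v.snd) = _
  rw [smul_eq_mul, mul_comm]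

/-- If `S₂ = S₁ ∘ Φ` on the open interval `I`, then the modulus of the coderivative of `S₂` is at
least that of `S₁` times `Φ'`. The inverse `Θ` serves to lift sequences of base points. -/
lemma asymModulus_mul_deriv_le {S₁ S₂ : ℝ → Set (E n)} {Φ Θ : ℝ → ℝ} {I J : Set ℝ}
    (hI : IsOpen I) (hJ : IsOpen J) (hΘJ : MapsTo Θ J I) (hinv : ∀ t ∈ J, Φ (Θ t) = t)
    (hΦ : ContDiffOn ℝ 1 Φ I) (hΘ : ContinuousOn Θ J) (hS : ∀ r ∈ I, S₂ r = S₁ (Φ r))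
    {t : ℝ} (ht : t ∈ J) (hpos : 0 < deriv Φ (Θ t)) (x : E n) :
    asymModulus S₁ t x * ENNReal.ofReal (deriv Φ (Θ t)) ≤ asymModulus S₂ (Θ t) x := by
  have hr : Θ t ∈ I := hΘJ ht
  have key : ∀ (α : ℝ) (u : E n),
      (WithLp.toLp 2 (α, u) : TE n) ∈ limitingNormalCone (gph S₁) (WithLp.toLp 2 (t, x)) →
      (WithLp.toLp 2 (α * deriv Φ (Θ t), u) : TE n) ∈
        limitingNormalCone (gph S₂) (WithLp.toLp 2 (Θ t, x)) := by
    rintro α u ⟨y, w, hy, hw, hyl, hwl⟩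
    have hyt : Tendsto (fun i => (y i).fst) atTop (𝓝 t) := (continuous_fst_TE.tendsto _).comp hyl
    obtain ⟨N, hN⟩ := eventually_atTop.1 (hyt.eventually (hJ.mem_nhds ht))
    have hyJ : ∀ i, (y (i + N)).fst ∈ J := fun i => hN _ (Nat.le_add_left _ _)
    have hsh : Tendsto (fun i : ℕ => i + N) atTop atTop := tendsto_add_atTop_nat N
    have hΘl : Tendsto (fun i => Θ (y (i + N)).fst) atTop (𝓝 (Θ t)) :=
      ((hΘ.continuousAt (hJ.mem_nhds ht)).tendsto.comp hyt).comp hsh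
    have hyx : Tendsto (fun i => (y (i + N)).snd) atTop (𝓝 x) :=
      ((continuous_snd_TE.tendsto _).comp hyl).comp hsh
    have hwN : Tendsto (fun i => w (i + N)) atTop (𝓝 (WithLp.toLp 2 (α, u))) := hwl.comp hsh
    refine ⟨fun i => WithLp.toLp 2 (Θ (y (i + N)).fst, (y (i + N)).snd),
      fun i => WithLp.toLp 2 ((w (i + N)).fst * deriv Φ (Θ (y (i + N)).fst), (w (i + N)).snd),
      fun i => ?_, fun i => ?_, ?_, ?_⟩
    · rw [mem_gph_toLp, hS _ (hΘJ (hyJ i)), hinv _ (hyJ i)]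
      exact hy (i + N)
    · have hrI := hΘJ (hyJ i)
      have hd : HasDerivAt Φ (deriv Φ (Θ (y (i + N)).fst)) (Θ (y (i + N)).fst) :=
        ((hΦ.contDiffAt (hI.mem_nhds hrI)).differentiableAt one_ne_zero).hasDerivAt
      obtain ⟨L, hL, hLd⟩ := hasFDerivAt_timeMap hd (y (i + N)).snd
      refine mem_frechet_of_hasFDerivAt (C₁ := gph S₁) (w₁ := w (i + N)) hLd ?_ (fun v => ?_) ?_
      · have hopen : IsOpen {q : TE n | q.fst ∈ I} := hI.preimage continuous_fst_TE
        filter_upwards [hopen.mem_nhds (show _ ∈ {q : TE n | q.fst ∈ I} from hrI)] with q hq hqS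
        rw [mem_gph_toLp, ← hS _ hq]
        exact hqS
      · rw [hL]
        refine (inner_toLp _ v.fst _ v.snd).trans (Eq.trans ?_
          (inner_toLp (w (i + N)).fst _ (w (i + N)).snd _).symm)
        ring
      · have : (WithLp.toLp 2 (Φ (Θ (y (i + N)).fst), (y (i + N)).snd) : TE n) = y (i + N) := by
          rw [hinv _ (hyJ i)]
          rfl
        have h1 := hw (i + N)
        rw [← this] at h1
        exact h1
    · exact (continuous_toLp.tendsto (Θ t, x)).comp (hΘl.prodMk_nhds hyx)
    · have hder : Tendsto (fun i => deriv Φ (Θ (y (i + N)).fst)) atTop (𝓝 (deriv Φ (Θ t))) :=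
        ((hΦ.continuousOn_deriv_of_isOpen hI le_rfl).continuousAt (hI.mem_nhds hr)).tendsto.comp hΘl
      exact (continuous_toLp.tendsto (α * deriv Φ (Θ t), u)).comp
        ((((continuous_fst_TE.tendsto _).comp hwN).mul hder).prodMk_nhds
          ((continuous_snd_TE.tendsto _).comp hwN))
  have h0 : ENNReal.ofReal (deriv Φ (Θ t)) ≠ 0 := (ENNReal.ofReal_pos.2 hpos).ne'
  rw [← ENNReal.le_div_iff_mul_le (Or.inl h0) (Or.inl ENNReal.ofReal_ne_top)]
  refine asymModulus_le fun u hu α hα => ?_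
  rw [ENNReal.le_div_iff_mul_le (Or.inl h0) (Or.inl ENNReal.ofReal_ne_top)]
  rw [← ENNReal.ofReal_mul' hpos.le]
  exact le_asymModulus hu (key α (-u) hα)

end TimeChange

/-! ### Integrals of the talweg -/

section Main

variable {n : ℕ} {S : ℝ → Set (E n)}

lemma IsSmoothSweepingProcess.hasConicChart (hS : IsSmoothSweepingProcess S) :
    ∀ p ∈ frontier (gph S), HasConicChart (gph S) p := by
  rcases hS.smooth with ⟨d, -, hd⟩ | h
  · exact hd.hasConicChart hS.closed
  · exact h.hasConicChart hS.closed

lemma ordConnected_dom (hS : IsSmoothSweepingProcess S) : (dom S).OrdConnected := by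
  have h1 : dom S = (fun q : TE n => q.fst) '' gph S := by
    ext t
    constructor
    · rintro ⟨x, hx⟩
      exact ⟨WithLp.toLp 2 (t, x), hx, rfl⟩
    · rintro ⟨q, hq, rfl⟩
      exact ⟨q.snd, hq⟩
  rw [h1]
  exact (hS.connected.isPreconnected.image _ continuous_fst_TE.continuousOn).ordConnected

/-- To the right of a regular time there is an interval on which the values are nonempty and the
talweg is finite and continuous. -/
lemma exists_regular_interval (hS : IsSmoothSweepingProcess S)
    (hbdd : ∀ t : ℝ, Bornology.IsBounded (S t)) {a : ℝ} (ha : a ∈ regularTimes S) :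
    ∃ c, a < c ∧ Icc a c ⊆ dom S ∧ ∀ t ∈ Ioc a c, talweg S t < ∞ ∧ ContinuousAt (talweg S) t := by
  obtain ⟨hadom, haT, ⟨δ, hδ, h2⟩, ⟨δ', hδ', h3⟩⟩ := ha
  obtain ⟨T, hT⟩ := lt_iSup_iff.1 haT
  obtain ⟨hTdom, haT'⟩ := lt_iSup_iff.1 hT
  have haT'' : a < T := EReal.coe_lt_coe_iff.1 haT'
  obtain ⟨c, hac, hc⟩ := exists_between (lt_min haT'' (lt_min (lt_add_of_pos_right a hδ)
    (lt_add_of_pos_right a hδ')))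
  refine ⟨c, hac, ((Icc_subset_Icc_right (hc.le.trans (min_le_left _ _))).trans
    ((ordConnected_dom hS).out hadom hTdom)), fun t ht => ?_⟩
  have htc := ht.2.trans_lt hc
  refine ⟨h2 t ⟨ht.1, htc.trans_le ((min_le_right _ _).trans (min_le_left _ _))⟩,
    continuousAt_talweg hS.closed hS.hasConicChart hbdd
      (h3 t ⟨ht.1, htc.trans_le ((min_le_right _ _).trans (min_le_right _ _))⟩)⟩

lemma length_le_lintegral_talweg (hC : ∀ p ∈ frontier (gph S), HasConicChart (gph S) p)
    {t₁ t₂ : ℝ} {γ : ℝ → E n} (h : SolvesSweeping S (Icc t₁ t₂) γ) :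
    length (Icc t₁ t₂) γ ≤ ∫⁻ t in Ioo t₁ t₂, talweg S t := by
  rw [length, ← restrict_Ioo_eq_restrict_Icc]
  refine lintegral_mono_ae ?_
  have h1 := ae_restrict_of_ae_restrict_of_subset Ioo_subset_Icc_self h.2
  filter_upwards [h1, ae_restrict_mem measurableSet_Ioo] with t ht htI
  have hev : ∀ᶠ s in 𝓝 t, γ s ∈ S s := by
    filter_upwards [Ioo_mem_nhds htI.1 htI.2] with s hs
    exact h.1 s (Ioo_subset_Icc_self hs)
  exact (enorm_deriv_le_asymModulus hC ht.1 hev ht.2).trans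
    (asymModulus_le_talweg hev.self_of_nhds)

/-- An integrable continuous talweg as a real function on the line, extended by zero. -/
lemma exists_integrable_talweg {a b : ℝ}
    (hreg : ∀ t ∈ Ioo a b, talweg S t < ∞ ∧ ContinuousAt (talweg S) t)
    (hint : ∫⁻ t in Icc a b, talweg S t < ⊤) :
    ∃ f : ℝ → ℝ, Integrable f ∧ (∀ t, 0 ≤ f t) ∧
      ∀ t ∈ Ioo a b, ContinuousAt f t ∧ talweg S t = ENNReal.ofReal (f t) := by
  have hcont : ∀ t ∈ Ioo a b, ContinuousAt (fun s => (talweg S s).toReal) t := fun t ht =>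
    (ENNReal.tendsto_toReal (hreg t ht).1.ne).comp (hreg t ht).2
  have hcongr : ∀ t ∈ Ioo a b,
      (Ioo a b).indicator (fun s => (talweg S s).toReal) t = (talweg S t).toReal :=
    fun t ht => indicator_of_mem ht _
  refine ⟨(Ioo a b).indicator fun s => (talweg S s).toReal, ?_,
    fun t => indicator_nonneg (fun _ _ => ENNReal.toReal_nonneg) t, fun t ht => ⟨?_, ?_⟩⟩
  · rw [integrable_indicator_iff measurableSet_Ioo]
    refine ⟨ContinuousOn.aestronglyMeasurable (fun t ht => (hcont t ht).continuousWithinAt)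
      measurableSet_Ioo, ?_⟩
    refine lt_of_le_of_lt (lintegral_mono_ae (g := talweg S) ?_)
      ((lintegral_mono_set Ioo_subset_Icc_self).trans_lt hint)
    filter_upwards with t
    rw [Real.enorm_of_nonneg ENNReal.toReal_nonneg]
    exact ENNReal.ofReal_toReal_le
  · refine (hcont t ht).congr ?_
    filter_upwards [Ioo_mem_nhds ht.1 ht.2] with s hs
    exact (hcongr s hs).symm
  · rw [hcongr t ht, ENNReal.ofReal_toReal (hreg t ht).1.ne]

/-! ### The four properties -/

/-- A desingularizing time change makes the talweg integrable: the talweg is at most the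
derivative of the inverse time change. -/
lemma lintegral_talweg_lt_top_of_timeChange {a b ρ : ℝ} {Ψ : ℝ → ℝ} (hΨ : IsTimeChange Ψ ρ a b)
    (h : ∀ r ∈ Ioo 0 ρ, ∀ x ∈ S (Ψ r), asymModulus (compOn S Ψ (Icc 0 ρ)) r x ≤ 1) :
    ∫⁻ t in Icc a b, talweg S t < ⊤ := by
  obtain ⟨⟨Θ, hΨm, hΘm, hinv, hΨc, hΘc, hΨo, hΘo, hΨ1, hΘ1⟩, hpos⟩ := hΨ
  have hΨΘ : ∀ t ∈ Ioo a b, Ψ (Θ t) = t := fun t ht => hinv.2 (Ioo_subset_Icc_self ht)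
  have hΘd : ∀ t ∈ Ioo a b, HasDerivAt Θ (deriv Θ t) t := fun t ht =>
    ((hΘ1.contDiffAt (isOpen_Ioo.mem_nhds ht)).differentiableAt one_ne_zero).hasDerivAt
  have hle : ∀ t ∈ Ioo a b, talweg S t ≤ ENNReal.ofReal |deriv Θ t| := by
    intro t ht
    have hp := hpos (Θ t) (hΘo ht)
    have hΨd : HasDerivAt Ψ (deriv Ψ (Θ t)) (Θ t) :=
      ((hΨ1.contDiffAt (isOpen_Ioo.mem_nhds (hΘo ht))).differentiableAt one_ne_zero).hasDerivAt
    have hmul : deriv Ψ (Θ t) * deriv Θ t = 1 := by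
      refine (hΨd.comp t (hΘd t ht)).unique ((hasDerivAt_id t).congr_of_eventuallyEq ?_)
      filter_upwards [isOpen_Ioo.mem_nhds ht] with s hs
      exact hΨΘ s hs
    have hΘt : deriv Θ t = (deriv Ψ (Θ t))⁻¹ := eq_inv_of_mul_eq_one_right hmul
    refine iSup₂_le fun x hx => ?_
    have h1 := asymModulus_mul_deriv_le (S₁ := S) (S₂ := compOn S Ψ (Icc 0 ρ)) isOpen_Ioo
      isOpen_Ioo hΘo hΨΘ hΨ1 (hΘc.mono Ioo_subset_Icc_self)
      (fun r hr => by ext y; exact ⟨fun hy => hy.2, fun hy => ⟨Ioo_subset_Icc_self hr, hy⟩⟩) ht hp x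
    have h2 := h1.trans (h (Θ t) (hΘo ht) x (by rwa [hΨΘ t ht]))
    rw [← ENNReal.le_div_iff_mul_le (Or.inl (ENNReal.ofReal_pos.2 hp).ne')
      (Or.inl ENNReal.ofReal_ne_top), one_div, ← ENNReal.ofReal_inv_of_pos hp] at h2
    rwa [hΘt, abs_of_pos (inv_pos.2 hp)]
  rw [← restrict_Ioo_eq_restrict_Icc]
  calc ∫⁻ t in Ioo a b, talweg S t ≤ ∫⁻ t in Ioo a b, ENNReal.ofReal |deriv Θ t| * 1 := by
        refine setLIntegral_mono' measurableSet_Ioo fun t ht => ?_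
        rw [mul_one]
        exact hle t ht
    _ = ∫⁻ _ in Θ '' Ioo a b, 1 := (lintegral_image_eq_lintegral_abs_deriv_mul measurableSet_Ioo
        (fun t ht => (hΘd t ht).hasDerivWithinAt)
        (fun s hs t ht hst => by rw [← hΨΘ s hs, ← hΨΘ t ht, hst]) (fun _ => 1)).symm
    _ ≤ volume (Icc 0 ρ) := by
        rw [setLIntegral_one]
        exact measure_mono (hΘm.mono_left Ioo_subset_Icc_self).image_subset
    _ < ⊤ := measure_Icc_lt_top

/-- If the talweg is integrable, the inverse of `t ↦ ∫ₐᵗ (φ↑ + 1)` desingularizes the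
coderivative. -/
lemma exists_timeChange {a b : ℝ} (hab : a < b) {f : ℝ → ℝ} (hf : Integrable f)
    (hf0 : ∀ t, 0 ≤ f t)
    (hft : ∀ t ∈ Ioo a b, ContinuousAt f t ∧ talweg S t = ENNReal.ofReal (f t)) :
    ∃ ρ, 0 < ρ ∧ ∃ Ψ : ℝ → ℝ, IsTimeChange Ψ ρ a b ∧
      ∀ r ∈ Ioo 0 ρ, ∀ x ∈ S (Ψ r), asymModulus (compOn S Ψ (Icc 0 ρ)) r x ≤ 1 := by
  set θ : ℝ → ℝ := fun t => (∫ s in a..t, f s) + (t - a) with hθ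
  have hii : ∀ c d, IntervalIntegrable f volume c d := fun c d => hf.intervalIntegrable
  have hsub : ∀ s t, θ t - θ s = (∫ r in s..t, f r) + (t - s) := fun s t => by
    rw [hθ]
    have := intervalIntegral.integral_add_adjacent_intervals (hii a s) (hii s t)
    simp only
    linarith
  have hge : ∀ s t, s ≤ t → t - s ≤ θ t - θ s := fun s t hst => by
    rw [hsub]
    have := intervalIntegral.integral_nonneg (μ := volume) hst fun r _ => hf0 r
    linarith
  have hmono : StrictMono θ := fun s t hst => by
    have := hge s t hst.le
    linarith
  have hθa : θ a = 0 := by simp [hθ]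
  have hcont : Continuous θ :=
    (intervalIntegral.continuous_primitive hii a).add (continuous_id.sub continuous_const)
  have hsurj : Function.Surjective θ := by
    refine hcont.surjective ?_ ?_
    · refine tendsto_atTop_mono' _ ?_ (tendsto_atTop_add_const_right atTop (-a) tendsto_id)
      filter_upwards [eventually_ge_atTop a] with t ht
      have := hge a t ht
      simp only [id]
      linarith
    · refine tendsto_atBot_mono' _ ?_ (tendsto_atBot_add_const_right atBot (-a) tendsto_id)
      filter_upwards [eventually_le_atBot a] with t ht
      have := hge t a ht
      simp only [id]
      linarith
  let e : ℝ ≃o ℝ := hmono.orderIsoOfSurjective θ hsurj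
  have heθ : ∀ t, e t = θ t := fun t => rfl
  have hρ : 0 < θ b := hθa ▸ hmono hab
  have hea : e.symm 0 = a := by rw [e.symm_apply_eq, heθ, hθa]
  have heb : e.symm (θ b) = b := e.symm_apply_apply b
  have hθd : ∀ t ∈ Ioo a b, HasDerivAt θ (f t + 1) t := fun t ht => by
    have hsm : StronglyMeasurableAtFilter f (𝓝 t) :=
      hf.aestronglyMeasurable.stronglyMeasurableAtFilter
    have h1 := intervalIntegral.integral_hasDerivAt_right (hii a t) hsm (hft t ht).1
    exact h1.add ((hasDerivAt_id t).sub_const a)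
  have hsymm : ∀ r ∈ Ioo 0 (θ b), e.symm r ∈ Ioo a b := fun r hr =>
    ⟨hea ▸ e.symm.strictMono hr.1, heb ▸ e.symm.strictMono hr.2⟩
  have hsc : Continuous e.symm := e.symm.continuous
  have hΨd : ∀ r ∈ Ioo 0 (θ b), HasDerivAt e.symm (f (e.symm r) + 1)⁻¹ r := fun r hr => by
    refine HasDerivAt.of_local_left_inverse hsc.continuousAt (hθd _ (hsymm r hr)) ?_ ?_
    · have := hf0 (e.symm r)
      positivity
    · exact Eventually.of_forall fun s => e.apply_symm_apply s
  have hθ1 : ContDiffOn ℝ 1 θ (Ioo a b) := by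
    rw [show (1 : WithTop ℕ∞) = 0 + 1 from rfl, contDiffOn_succ_iff_deriv_of_isOpen isOpen_Ioo]
    refine ⟨fun t ht => (hθd t ht).differentiableAt.differentiableWithinAt, by simp, ?_⟩
    rw [contDiffOn_zero]
    have : ContinuousOn (fun t => f t + 1) (Ioo a b) := fun t ht =>
      ((hft t ht).1.add continuousAt_const).continuousWithinAt
    exact this.congr fun t ht => (hθd t ht).deriv
  have hΨ1 : ContDiffOn ℝ 1 e.symm (Ioo 0 (θ b)) := by
    rw [show (1 : WithTop ℕ∞) = 0 + 1 from rfl, contDiffOn_succ_iff_deriv_of_isOpen isOpen_Ioo]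
    refine ⟨fun r hr => (hΨd r hr).differentiableAt.differentiableWithinAt, by simp, ?_⟩
    rw [contDiffOn_zero]
    have : ContinuousOn (fun r => (f (e.symm r) + 1)⁻¹) (Ioo 0 (θ b)) := fun r hr => by
      have h1 : ContinuousAt (fun r => f (e.symm r)) r :=
        ContinuousAt.comp (hft _ (hsymm r hr)).1 hsc.continuousAt
      refine ((h1.add continuousAt_const).inv₀ ?_).continuousWithinAt
      have := hf0 (e.symm r)
      exact (show 0 < f (e.symm r) + 1 by positivity).ne'
    exact this.congr fun r hr => (hΨd r hr).deriv
  refine ⟨θ b, hρ, e.symm, ⟨⟨θ, ?_, ?_, ⟨?_, ?_⟩, hsc.continuousOn, hcont.continuousOn, hsymm, ?_,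
    hΨ1, hθ1⟩, ?_⟩, ?_⟩
  · exact fun r hr => ⟨hea ▸ e.symm.monotone hr.1, heb ▸ e.symm.monotone hr.2⟩
  · exact fun t ht => ⟨hθa ▸ hmono.monotone ht.1, hmono.monotone ht.2⟩
  · exact fun r _ => e.apply_symm_apply r
  · exact fun t _ => e.symm_apply_apply t
  · exact fun t ht => ⟨hθa ▸ hmono ht.1, hmono ht.2⟩
  · intro r hr
    rw [(hΨd r hr).deriv]
    have := hf0 (e.symm r)
    positivity
  · intro r hr x hx
    have ht := hsymm r hr
    have hd : deriv θ (e.symm r) = f (e.symm r) + 1 := (hθd _ ht).deriv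
    have hp : 0 < deriv θ (e.symm r) := by
      rw [hd]
      have := hf0 (e.symm r)
      positivity
    have h1 := asymModulus_mul_deriv_le (S₁ := compOn S e.symm (Icc 0 (θ b))) (S₂ := S)
      (Φ := θ) (Θ := e.symm) (I := Ioo a b) (J := Ioo 0 (θ b)) isOpen_Ioo isOpen_Ioo hsymm
      (fun r _ => e.apply_symm_apply r) hθ1 hsc.continuousOn (fun t ht => by
        have h2 : e.symm (θ t) = t := e.symm_apply_apply t
        ext y
        constructor
        · exact fun hy => ⟨⟨hθa ▸ (hmono ht.1).le, (hmono ht.2).le⟩, by rwa [h2]⟩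
        · rintro ⟨-, hy⟩
          rwa [h2] at hy) hr hp x
    have h2 : asymModulus S (e.symm r) x ≤ ENNReal.ofReal (deriv θ (e.symm r)) := by
      refine (asymModulus_le_talweg hx).trans ?_
      rw [(hft _ ht).2, hd]
      exact ENNReal.ofReal_le_ofReal (by linarith)
    have h3 := h1.trans h2
    rw [← ENNReal.le_div_iff_mul_le (Or.inl (ENNReal.ofReal_pos.2 hp).ne')
      (Or.inl ENNReal.ofReal_ne_top), ENNReal.div_self (ENNReal.ofReal_pos.2 hp).ne'
      ENNReal.ofReal_ne_top] at h3
    exact h3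

/-- If the talweg is integrable, its primitive controls the lengths of the orbits. -/
lemma exists_length_control (hC : ∀ p ∈ frontier (gph S), HasConicChart (gph S) p)
    {a b : ℝ} {f : ℝ → ℝ} (hf : Integrable f) (hf0 : ∀ t, 0 ≤ f t)
    (hft : ∀ t ∈ Ioo a b, talweg S t = ENNReal.ofReal (f t)) :
    ∃ σ : ℝ → ℝ, Continuous σ ∧ Monotone σ ∧ σ a = 0 ∧
      ∀ t₁ t₂ : ℝ, a ≤ t₁ → t₁ < t₂ → t₂ ≤ b → ∀ γ ∈ AC S (Icc t₁ t₂),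
        length (Icc t₁ t₂) γ ≤ ENNReal.ofReal (σ t₂ - σ t₁) := by
  have hii : ∀ c d, IntervalIntegrable f volume c d := fun c d => hf.intervalIntegrable
  have hsub : ∀ s t, (∫ r in a..t, f r) - (∫ r in a..s, f r) = ∫ r in s..t, f r := fun s t =>
    intervalIntegral.integral_interval_sub_left (hii a t) (hii a s)
  refine ⟨fun t => ∫ s in a..t, f s, intervalIntegral.continuous_primitive hii a,
    fun s t hst => ?_, by simp, ?_⟩
  · have := intervalIntegral.integral_nonneg (μ := volume) hst fun r _ => hf0 r
    have := hsub s t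
    simp only
    linarith
  · intro t₁ t₂ h1 h12 h2 γ hγ
    refine (length_le_lintegral_talweg hC hγ.2).trans ?_
    simp only
    rw [hsub, intervalIntegral.integral_of_le h12.le, integral_Ioc_eq_integral_Ioo,
      ofReal_integral_eq_lintegral_ofReal hf.integrableOn (Eventually.of_forall hf0)]
    refine (setLIntegral_congr_fun measurableSet_Ioo fun t ht => ?_).le
    exact hft t ⟨h1.trans_lt ht.1, ht.2.trans_le h2⟩

/-- A uniform length control makes the talweg integrable. By continuous induction, the
control `σ(t) + t` grows at least as fast as the integral of the talweg, because orbits of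
nearly maximal speed start at every time. -/
lemma lintegral_talweg_lt_top_of_length_control (hcl : IsClosed (gph S))
    (hC : ∀ p ∈ frontier (gph S), HasConicChart (gph S) p) (hA1 : ExistenceAssumption S)
    {a b : ℝ} (hab : a < b) (hdom : Icc a b ⊆ dom S)
    (hreg : ∀ t ∈ Ioc a b, talweg S t < ∞ ∧ ContinuousAt (talweg S) t) {σ : ℝ → ℝ}
    (hσc : ContinuousOn σ (Icc a b)) (hσm : MonotoneOn σ (Icc a b)) (hσa : σ a = 0)
    (hσ : ∀ t₁ t₂ : ℝ, a ≤ t₁ → t₁ < t₂ → t₂ ≤ b → ∀ γ ∈ AC S (Icc t₁ t₂),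
      length (Icc t₁ t₂) γ ≤ ENNReal.ofReal (σ t₂ - σ t₁)) :
    ∫⁻ t in Icc a b, talweg S t < ⊤ := by
  set f : ℝ → ℝ := fun s => (talweg S s).toReal with hf
  have hfc : ∀ t ∈ Ioc a b, ContinuousAt f t := fun t ht =>
    (ENNReal.tendsto_toReal (hreg t ht).1.ne).comp (hreg t ht).2
  have hfI : ∀ s t, a < s → s ≤ t → t ≤ b → IntegrableOn f (Icc s t) := fun s t hs hst ht =>
    ContinuousOn.integrableOn_Icc fun r hr =>
      (hfc r ⟨hs.trans_le hr.1, hr.2.trans ht⟩).continuousWithinAt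
  have hfi : ∀ s t, a < s → s ≤ t → t ≤ b → IntervalIntegrable f volume s t :=
    fun s t hs hst ht => (intervalIntegrable_iff_integrableOn_Icc_of_le hst).2 (hfI s t hs hst ht)
  have hfl : ∀ s t, a < s → s ≤ t → t ≤ b →
      ENNReal.ofReal (∫ r in s..t, f r) = ∫⁻ r in Icc s t, talweg S r := fun s t hs hst ht => by
    rw [intervalIntegral.integral_of_le hst, ← integral_Icc_eq_integral_Ioc,
      ofReal_integral_eq_lintegral_ofReal (hfI s t hs hst ht)
        (Eventually.of_forall fun _ => ENNReal.toReal_nonneg)]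
    exact setLIntegral_congr_fun measurableSet_Icc fun r hr =>
      ENNReal.ofReal_toReal (hreg r ⟨hs.trans_le hr.1, hr.2.trans ht⟩).1.ne
  -- one step to the right
  have hstep : ∀ x ∈ Ioo a b, ∃ e, x < e ∧ ∀ s ∈ Ioo x e, s ≤ b →
      ∫ r in x..s, f r ≤ σ s - σ x + (s - x) := by
    intro x hx
    obtain ⟨e, hxe, γ, hγ, hfast⟩ := exists_fast_orbit hcl hC hA1
      (hdom (Ioo_subset_Icc_self hx)) (hreg x (Ioo_subset_Ioc_self hx)).1 (hreg x (Ioo_subset_Ioc_self hx)).2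
    refine ⟨e, hxe, fun s hs hsb => ?_⟩
    have hγs : γ ∈ AC S (Icc x s) := AC.mono (Icc_subset_Ico_right hs.2) hγ
    have hσ0 : 0 ≤ σ s - σ x := sub_nonneg.2
      (hσm (Ioo_subset_Icc_self hx)
        (show s ∈ Icc a b from ⟨(hx.1.trans hs.1).le, hsb⟩) hs.1.le)
    have hsx : 0 ≤ s - x := sub_nonneg.2 hs.1.le
    rw [← ENNReal.ofReal_le_ofReal_iff (by linarith), hfl x s hx.1 hs.1.le hsb,
      ENNReal.ofReal_add hσ0 hsx]
    calc ∫⁻ r in Icc x s, talweg S r ≤ ∫⁻ r in Icc x s, (‖deriv γ r‖ₑ + 1) := by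
          rw [← restrict_Ioo_eq_restrict_Icc]
          refine lintegral_mono_ae ?_
          have h1 := ae_restrict_of_ae_restrict_of_subset Ioo_subset_Icc_self hγs.2.2
          filter_upwards [h1, ae_restrict_mem measurableSet_Ioo] with r hr hrI
          exact hfast r ⟨hrI.1, hrI.2.trans hs.2⟩ hr.1
      _ = length (Icc x s) γ + ENNReal.ofReal (s - x) := by
          rw [lintegral_add_right _ measurable_const, setLIntegral_one, Real.volume_Icc, length]
      _ ≤ _ := by
          gcongr
          exact hσ x s hx.1.le hs.1 hsb γ hγs
  have hbound : ∀ t₀ ∈ Ioo a b, ∫⁻ t in Icc t₀ b, talweg S t ≤ ENNReal.ofReal (σ b + (b - a)) := by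
    intro t₀ ht₀
    set Z : Set ℝ := {s | ∫ r in t₀..s, f r ≤ σ s - σ t₀ + (s - t₀)} with hZ
    have hclosed : IsClosed (Z ∩ Icc t₀ b) := by
      have h1 : ContinuousOn (fun s => ∫ r in t₀..s, f r) (Icc t₀ b) :=
        intervalIntegral.continuousOn_primitive_interval'
          (hfi t₀ b ht₀.1 ht₀.2.le le_rfl) (left_mem_uIcc) |>.mono
            (by rw [uIcc_of_le ht₀.2.le])
      have h2 : ContinuousOn (fun s => σ s - σ t₀ + (s - t₀)) (Icc t₀ b) :=
        ((hσc.mono (Icc_subset_Icc_left ht₀.1.le)).sub continuousOn_const).add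
          (continuousOn_id.sub continuousOn_const)
      have h3 := isClosed_Icc.isClosed_le h1 h2
      have h4 : Z ∩ Icc t₀ b =
          {x ∈ Icc t₀ b | ∫ r in t₀..x, f r ≤ σ x - σ t₀ + (x - t₀)} := by
        ext s
        exact and_comm
      rw [h4]
      exact h3
    have hall : Icc t₀ b ⊆ Z := by
      refine hclosed.Icc_subset_of_forall_mem_nhdsWithin (by simp [hZ]) ?_
      rintro x ⟨hxZ, hx⟩
      have hax : a < x := ht₀.1.trans_le hx.1
      obtain ⟨e, hxe, hes⟩ := hstep x ⟨hax, hx.2⟩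
      filter_upwards [Ioo_mem_nhdsGT (lt_min hxe hx.2)] with s hs
      have hsb : s ≤ b := (hs.2.trans_le (min_le_right _ _)).le
      have h1 := hes s ⟨hs.1, hs.2.trans_le (min_le_left _ _)⟩ hsb
      have h2 : ∫ r in t₀..x, f r ≤ σ x - σ t₀ + (x - t₀) := hxZ
      have h3 := intervalIntegral.integral_add_adjacent_intervals
        (hfi t₀ x ht₀.1 hx.1 hx.2.le) (hfi x s hax hs.1.le hsb)
      change ∫ r in t₀..s, f r ≤ σ s - σ t₀ + (s - t₀)
      linarith
    have h1 : ∫ r in t₀..b, f r ≤ σ b - σ t₀ + (b - t₀) := hall ⟨ht₀.2.le, le_rfl⟩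
    have h2 : 0 ≤ σ t₀ := hσa ▸ hσm ⟨le_rfl, hab.le⟩ (Ioo_subset_Icc_self ht₀) ht₀.1.le
    rw [← hfl t₀ b ht₀.1 ht₀.2.le le_rfl]
    exact ENNReal.ofReal_le_ofReal (by linarith [ht₀.1])
  set s : ℕ → ℝ := fun k => a + (b - a) / ((k : ℝ) + 2) with hs
  have hba : 0 < b - a := sub_pos.2 hab
  have hsI : ∀ k, s k ∈ Ioo a b := fun k => by
    refine ⟨lt_add_of_pos_right a (by positivity), ?_⟩
    have : (b - a) / ((k : ℝ) + 2) < b - a := by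
      rw [div_lt_iff₀ (by positivity)]
      nlinarith [Nat.cast_nonneg (α := ℝ) k]
    simp only [hs]
    linarith
  have hanti : Antitone s := fun k l hkl => by
    simp only [hs]
    gcongr
  have hU : Ioc a b ⊆ ⋃ k, Icc (s k) b := by
    intro t ht
    obtain ⟨k, hk⟩ := exists_nat_gt ((b - a) / (t - a))
    refine mem_iUnion.2 ⟨k, ?_, ht.2⟩
    have hta : 0 < t - a := sub_pos.2 ht.1
    rw [div_lt_iff₀ hta] at hk
    have : (b - a) / ((k : ℝ) + 2) ≤ t - a := by
      rw [div_le_iff₀ (by positivity)]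
      nlinarith
    simp only [hs]
    linarith
  rw [← restrict_Ioc_eq_restrict_Icc]
  refine ((lintegral_mono_set hU).trans ?_).trans_lt (ENNReal.ofReal_lt_top (r := σ b + (b - a)))
  rw [setLIntegral_iUnion_of_directed]
  · exact iSup_le fun k => hbound _ (hsI k)
  · exact (monotone_nat_of_le_succ fun k =>
      Icc_subset_Icc_left (hanti (Nat.le_succ k))).directed_le

end Main

end Sweeping

theorem theoremA (n : ℕ) (S : ℝ → Set (Sweeping.E n))
    (hS : Sweeping.IsSmoothSweepingProcess S)
    (hbdd : ∀ t : ℝ, Bornology.IsBounded (S t))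
    (hA1 : Sweeping.ExistenceAssumption S)
    (a : ℝ) (ha : a ∈ Sweeping.regularTimes S) :
    List.TFAE [
      -- (a) desingularization of the coderivative
      ∃ b ρ : ℝ, a < b ∧ 0 < ρ ∧ ∃ Ψ : ℝ → ℝ, Sweeping.IsTimeChange Ψ ρ a b ∧
        ∀ r ∈ Set.Ioo 0 ρ, ∀ x ∈ S (Ψ r),
          Sweeping.asymModulus (Sweeping.compOn S Ψ (Set.Icc 0 ρ)) r x ≤ 1,
      -- (b) uniform length control for the absolutely continuous orbits
      ∃ b : ℝ, a < b ∧ ∃ σ : ℝ → ℝ, ContinuousOn σ (Set.Icc a b) ∧ MonotoneOn σ (Set.Icc a b) ∧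
        σ a = 0 ∧ ∀ t₁ t₂ : ℝ, a ≤ t₁ → t₁ < t₂ → t₂ ≤ b →
          ∀ γ ∈ Sweeping.AC S (Set.Icc t₁ t₂),
            Sweeping.length (Set.Icc t₁ t₂) γ ≤ ENNReal.ofReal (σ t₂ - σ t₁),
      -- (c) length bound for the piecewise absolutely continuous orbits
      ∃ b : ℝ, a < b ∧ (Sweeping.PAC S (Set.Icc a b)).Nonempty ∧ ∃ M : ℝ, 0 < M ∧
        ∀ γ ∈ Sweeping.PAC S (Set.Icc a b),
          Sweeping.length (Set.Icc a b) γ ≤ ENNReal.ofReal M,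
      -- (d) integrability of the oriented talweg
      ∃ b : ℝ, a < b ∧ Set.Icc a b ⊆ Sweeping.dom S ∧
        ∫⁻ t in Set.Icc a b, Sweeping.talweg S t < ⊤] := by
  open Sweeping in
  obtain ⟨c, hac, hdom, hreg⟩ := exists_regular_interval hS hbdd ha
  have hC := hS.hasConicChart
  have hfast : ∀ t ∈ Ioc a c, ∃ e, t < e ∧ ∃ γ ∈ AC S (Ico t e), ∀ s ∈ Ioo t e,
      DifferentiableAt ℝ γ s → talweg S s ≤ ‖deriv γ s‖ₑ + 1 := fun t ht =>
    exists_fast_orbit hS.closed hC hA1 (hdom (Ioc_subset_Icc_self ht)) (hreg t ht).1 (hreg t ht).2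
  tfae_have 1 → 4 := by
    rintro ⟨b, ρ, hab, -, Ψ, hΨ, h⟩
    refine ⟨min b c, lt_min hab hac, (Icc_subset_Icc_right (min_le_right _ _)).trans hdom, ?_⟩
    exact (lintegral_mono_set (Icc_subset_Icc_right (min_le_left _ _))).trans_lt
      (lintegral_talweg_lt_top_of_timeChange hΨ h)
  tfae_have 4 → 1 := by
    rintro ⟨b, hab, -, hint⟩
    obtain ⟨f, hf, hf0, hft⟩ := exists_integrable_talweg (S := S) (a := a) (b := min b c)
      (fun t ht => hreg t ⟨ht.1, ht.2.le.trans (min_le_right _ _)⟩)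
      ((lintegral_mono_set (Icc_subset_Icc_right (min_le_left _ _))).trans_lt hint)
    obtain ⟨ρ, hρ, Ψ, hΨ, h⟩ := exists_timeChange (lt_min hab hac) hf hf0 hft
    exact ⟨_, ρ, lt_min hab hac, hρ, Ψ, hΨ, h⟩
  tfae_have 4 → 2 := by
    rintro ⟨b, hab, -, hint⟩
    obtain ⟨f, hf, hf0, hft⟩ := exists_integrable_talweg (S := S) (a := a) (b := min b c)
      (fun t ht => hreg t ⟨ht.1, ht.2.le.trans (min_le_right _ _)⟩)
      ((lintegral_mono_set (Icc_subset_Icc_right (min_le_left _ _))).trans_lt hint)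
    obtain ⟨σ, hσc, hσm, hσa, hσ⟩ := exists_length_control hC hf hf0 fun t ht => (hft t ht).2
    exact ⟨_, lt_min hab hac, σ, hσc.continuousOn, hσm.monotoneOn _, hσa, hσ⟩
  tfae_have 4 → 3 := by
    rintro ⟨b, hab, -, hint⟩
    set d := min b c with hd
    have had : a < d := lt_min hab hac
    have hint' : ∫⁻ t in Icc a d, talweg S t < ⊤ :=
      (lintegral_mono_set (Icc_subset_Icc_right (min_le_left _ _))).trans_lt hint
    have hsel : ∀ t, ∃ x, t ∈ Icc a d → x ∈ S t := fun t => by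
      by_cases ht : t ∈ Icc a d
      · obtain ⟨x, hx⟩ := hdom ⟨ht.1, ht.2.trans (min_le_right _ _)⟩
        exact ⟨x, fun _ => hx⟩
      · exact ⟨0, fun h => absurd h ht⟩
    choose γ₀ hγ₀ using hsel
    have hPAC₀ : γ₀ ∈ PAC S (Icc d d) := by
      refine ⟨⟨{d}, isClosed_singleton, countable_singleton d, fun s t hst h => ?_⟩,
        fun t ht => hγ₀ t ⟨had.le.trans ht.1, ht.2⟩, ?_⟩
      · have := h ⟨le_rfl, hst⟩
        rw [Icc_self, sdiff_self] at this
        exact absurd this (notMem_empty s)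
      · rw [Icc_self, Measure.restrict_singleton, Real.volume_singleton, zero_smul]
        exact ae_zero.le trivial
    obtain ⟨γ, hγ, -⟩ := exists_glued_orbit had hγ₀ hPAC₀ (P := fun _ _ => True) fun t ht => by
      obtain ⟨e, he, γ, hγ, -⟩ := hfast t ⟨ht.1, ht.2.le.trans (min_le_right _ _)⟩
      exact ⟨e, he, γ, hγ, fun _ _ _ => trivial⟩
    refine ⟨d, had, ⟨γ, hγ⟩, (∫⁻ t in Icc a d, talweg S t).toReal + 1,
      add_pos_of_nonneg_of_pos ENNReal.toReal_nonneg one_pos, fun η hη => ?_⟩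
    refine (length_le_lintegral_talweg hC hη.2).trans
      ((lintegral_mono_set Ioo_subset_Icc_self).trans ?_)
    rw [← ENNReal.ofReal_toReal hint'.ne]
    exact ENNReal.ofReal_le_ofReal (by simp)
  tfae_have 2 → 4 := by
    rintro ⟨b, hab, σ, hσc, hσm, hσa, hσ⟩
    have had : a < min b c := lt_min hab hac
    have hsub : Icc a (min b c) ⊆ Icc a b := Icc_subset_Icc_right (min_le_left _ _)
    have hdom' := (Icc_subset_Icc_right (min_le_right b c)).trans hdom
    refine ⟨min b c, had, hdom', lintegral_talweg_lt_top_of_length_control hS.closed hC hA1 had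
      hdom' (fun t ht => hreg t ⟨ht.1, ht.2.trans (min_le_right _ _)⟩) (hσc.mono hsub)
      (hσm.mono hsub) hσa fun t₁ t₂ h1 h12 h2 => hσ t₁ t₂ h1 h12 (h2.trans (min_le_left _ _))⟩
  tfae_have 3 → 4 := by
    rintro ⟨b, hab, ⟨γ₀, hγ₀⟩, M, -, hM⟩
    set d := min b c with hd
    have had : a < d := lt_min hab hac
    have hdb : d ≤ b := min_le_left _ _
    refine ⟨d, had, (Icc_subset_Icc_right (min_le_right _ _)).trans hdom, ?_⟩
    obtain ⟨γ, hγ, hγP⟩ := exists_glued_orbit had hγ₀.2.1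
      (PAC.mono (Icc_subset_Icc_left had.le) hγ₀)
      (P := fun s v => talweg S s ≤ ‖v‖ₑ + 1)
      fun t ht => hfast t ⟨ht.1, ht.2.le.trans (min_le_right _ _)⟩
    rw [← restrict_Ioo_eq_restrict_Icc]
    calc ∫⁻ t in Ioo a d, talweg S t ≤ ∫⁻ t in Ioo a d, (‖deriv γ t‖ₑ + 1) := lintegral_mono_ae hγP
      _ = (∫⁻ t in Ioo a d, ‖deriv γ t‖ₑ) + volume (Ioo a d) := by
          rw [lintegral_add_right _ measurable_const, setLIntegral_one]
      _ ≤ ENNReal.ofReal M + volume (Ioo a d) := by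
          gcongr
          exact (lintegral_mono_set (Ioo_subset_Icc_self.trans (Icc_subset_Icc_right hdb))).trans
            (hM γ hγ)
      _ < ⊤ := ENNReal.add_lt_top.2 ⟨ENNReal.ofReal_lt_top, measure_Ioo_lt_top⟩
  tfae_finish
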